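/- Let $M$ be a smooth finite-dimensional (Hausdorff) manifold and $L\to M$ a smooth real line bundle. Let $\widetilde M=L^*\smallsetminus 0$ be the dual bundle with its zero section removed, $p:\widetilde M\to M$ the projection, and, for $r\in\mathbb R^\times$, let $h_r:\widetilde M\to\widetilde M$, $h_r(\epsilon)=r\epsilon$. For $\lambda\in\Gamma(L)$ let $\widetilde\lambda\in C^\infty(\widetilde M)$ be $\widetilde\lambda(\epsilon)=\langle\epsilon,\lambda_{p(\epsilon)}\rangle$. Let $J^1L\to M$ be the first jet bundle of $L$, and let $DL\to M$ be the bundle whose fibre at $x$ consists of the linear maps $\Delta:\Gamma(L)\to L_x$ for which there is $v\in T_xM$ with $\Delta(f\lambda)=v(f)\lambda_x+f(x)\Delta\lambda$ for all $f\in C^\infty(M)$, $\lambda\in\Gamma(L)$. For $l,m\ge 0$, an Atiyah $(l,m)$-tensor on $L$ is a smooth section of $(DL)^{*\otimes l}\otimes(J^1L)^{*\otimes m}\otimes L$, i.e. a vector bundle map $(DL)^{\otimes l}\otimes(J^1L)^{\otimes m}\to L$. An $(l,m)$-tensor $\mathcal T$ on $\widetilde M$, i.e. a smooth section of $(T^*\widetilde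 M)^{\otimes l}\otimes(T\widetilde M)^{\otimes m}$, is homogeneous if $h_r^*\mathcal T=r^{1-m}\mathcal T$ for all $r\in\mathbb R^\times$. Theorem. There are isomorphisms of smooth vector bundles over $\widetilde M$ $$p_T:T\widetilde M\to p^*DL,\qquad p_{T^*}:T^*\widetilde M\to p^*J^1L$$ with $\langle\epsilon,p_T(v)\lambda\rangle=v(\widetilde\lambda)$ and $p_{T^*}(d_\epsilon\widetilde\lambda)=j^1_{p(\epsilon)}\lambda$ for all $\epsilon\in\widetilde M$, $v\in T_\epsilon\widetilde M$, $\lambda\in\Gamma(L)$, and for all $l,m\ge 0$ there is an isomorphism of smooth vector bundles over $\widetilde M$ $$\Phi:(T^*\widetilde M)^{\otimes l}\otimes(T\widetilde M)^{\otimes m}\to p^*\big((DL)^{*\otimes l}\otimes(J^1L)^{*\otimes m}\otimes L\big)$$ given by $$\langle\epsilon,\Phi(\mathcal T)(p_Tv_1,\dots,p_Tv_l;p_{T^*}\theta_1,\dots,p_{T^*}\theta_m)\rangle=\mathcal T(v_1,\dots,v_l;\theta_1,\dots,\theta_m)$$ for $\epsilon\in\widetilde M$, $\mathcal T\in(T_\epsilon^*\widetilde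 M)^{\otimes l}\otimes(T_\epsilon\widetilde M)^{\otimes m}$, $v_i\in T_\epsilon\widetilde M$, $\theta_j\in T^*_\epsilon\widetilde M$. Under $\Phi$, a smooth $(l,m)$-tensor $\mathcal T$ on $\widetilde M$ is homogeneous if and only if it corresponds to a pull-back section, i.e. $\Phi\circ\mathcal T=p^*T$ for some Atiyah $(l,m)$-tensor $T$ on $L$. Moreover $T\mapsto\Phi^{-1}\circ p^*T$ is an $\mathbb R$-linear bijection from the Atiyah $(l,m)$-tensors on $L$ onto the homogeneous $(l,m)$-tensors on $\widetilde M$. -/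

import Mathlib

open Bundle Set Filter Topology
open scoped Manifold ContDiff Bundle

universe u v w

noncomputable section

/-- A smooth real vector bundle over `B`. -/
structure SmoothVB {E H : Type} [NormedAddCommGroup E] [NormedSpace ℝ E] [TopologicalSpace H]
    (I : ModelWithCorners ℝ E H) (B : Type u) [TopologicalSpace B] [ChartedSpace H B] where
  /-- the model fibre -/
  F : Type
  [normF : NormedAddCommGroup F]
  [spaceF : NormedSpace ℝ F]
  /-- the fibres -/
  V : B → Type v
  [addV : ∀ x, AddCommGroup (V x)]
  [modV : ∀ x, Module ℝ (V x)]
  [topV : ∀ x, TopologicalSpace (V x)]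
  [tagV : ∀ x, IsTopologicalAddGroup (V x)]
  [smulV : ∀ x, ContinuousSMul ℝ (V x)]
  [topTotal : TopologicalSpace (TotalSpace F V)]
  [fib : FiberBundle F V]
  [vec : VectorBundle ℝ F V]
  [smooth : ContMDiffVectorBundle ∞ F V I]

attribute [instance] SmoothVB.normF SmoothVB.spaceF SmoothVB.addV SmoothVB.modV SmoothVB.topV
  SmoothVB.tagV SmoothVB.smulV SmoothVB.topTotal SmoothVB.fib SmoothVB.vec SmoothVB.smooth

namespace SmoothVB

section
variable {E H : Type} [NormedAddCommGroup E] [NormedSpace ℝ E] [TopologicalSpace H]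
  {I : ModelWithCorners ℝ E H} {B : Type u} [TopologicalSpace B] [ChartedSpace H B]

/-- Smooth sections. -/
abbrev Sec (A : SmoothVB.{u, v} I B) : Type (max u v) := ContMDiffSection I A.F ∞ A.V

/-- The bundle `Hom(A, C)`. -/
def hom (A C : SmoothVB.{u, v} I B) : SmoothVB I B where
  F := A.F →L[ℝ] C.F
  V := fun x => A.V x →L[ℝ] C.V x

/-- The bundle of maps `A × ⋯ × A → C` (with `k` factors), linear in each argument, in curried
form: `Hom(A, Hom(A, …, Hom(A, C)))`. -/
def multi (A C : SmoothVB.{u, v} I B) : ℕ → SmoothVB I B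
  | 0 => C
  | k + 1 => hom A (multi A C k)

/-- Evaluation of a `k`-linear map on `k` vectors. -/
def eval (A C : SmoothVB.{u, v} I B) {x : B} : (k : ℕ) → (multi A C k).V x → (Fin k → A.V x) → C.V x
  | 0, T, _ => T
  | k + 1, T, v =>
    eval A C k ((show A.V x →L[ℝ] (multi A C k).V x from T) (v 0)) (fun i => v i.succ)

/-- The product line bundle. -/
def trivialLine (I : ModelWithCorners ℝ E H) (B : Type u) [TopologicalSpace B] [ChartedSpace H B] :
    SmoothVB.{u, 0} I B where
  F := ℝ
  V := Bundle.Trivial B ℝ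


/-- The tangent bundle. -/
def tangent (I : ModelWithCorners ℝ E H) (B : Type u) [TopologicalSpace B] [ChartedSpace H B]
    [IsManifold I ∞ B] : SmoothVB.{u, 0} I B where
  F := E
  V := TangentSpace I

/-- The cotangent bundle. -/
def cotangent (I : ModelWithCorners ℝ E H) (B : Type u) [TopologicalSpace B] [ChartedSpace H B]
    [IsManifold I ∞ B] : SmoothVB.{u, 0} I B :=
  hom (tangent I B) (trivialLine I B)

/-- The pull-back of a smooth vector bundle along a smooth map. -/
def pullback {E' H' : Type} [NormedAddCommGroup E'] [NormedSpace ℝ E'] [TopologicalSpace H']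
    {I' : ModelWithCorners ℝ E' H'} {B' : Type w} [TopologicalSpace B'] [ChartedSpace H' B']
    (f : ContMDiffMap I' I B' B ∞) (A : SmoothVB.{u, v} I B) : SmoothVB.{w, v} I' B' where
  F := A.F
  V := f *ᵖ A.V
  addV := fun x => inferInstanceAs (AddCommGroup (A.V (f x)))
  modV := fun x => inferInstanceAs (Module ℝ (A.V (f x)))
  tagV := fun x => inferInstanceAs (IsTopologicalAddGroup (A.V (f x)))
  smulV := fun x => inferInstanceAs (ContinuousSMul ℝ (A.V (f x)))

/-- The pretrivialization of the family `V'` induced from a trivialization of `A` by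
fibrewise linear isomorphisms `V' x ≃ A.V x`. -/
def transportPre (A : SmoothVB.{u, v} I B) (V' : B → Type w) [∀ x, AddCommGroup (V' x)]
    [∀ x, Module ℝ (V' x)] (Φ : ∀ x, V' x ≃ₗ[ℝ] A.V x)
    (e : Trivialization A.F (π A.F A.V)) [e.IsLinear ℝ] : Pretrivialization A.F (π A.F V') where
  toFun p := e ⟨p.1, Φ p.1 p.2⟩
  invFun q := ⟨q.1, (Φ q.1).symm (e.symm q.1 q.2)⟩
  source := π A.F V' ⁻¹' e.baseSet
  target := e.baseSet ×ˢ univ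
  baseSet := e.baseSet
  open_baseSet := e.open_baseSet
  open_target := e.open_baseSet.prod isOpen_univ
  source_eq := rfl
  target_eq := rfl
  map_source' := by
    rintro ⟨x, v⟩ h
    have h' : x ∈ e.baseSet := h
    refine ⟨?_, mem_univ _⟩
    have h1 : (e ⟨x, Φ x v⟩).1 = x := e.coe_fst' h'
    exact h1.symm ▸ h'
  map_target' := fun q h => h.1
  left_inv' := by
    rintro ⟨x, v⟩ h
    have h' : x ∈ e.baseSet := h
    have h1 : (e ⟨x, Φ x v⟩).1 = x := e.coe_fst' h'
    have h2 : e ⟨x, Φ x v⟩ = (x, (e ⟨x, Φ x v⟩).2) := Prod.ext h1 rfl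
    rw [h2]
    simp only
    congr 1
    rw [e.symm_apply_apply_mk h', LinearEquiv.symm_apply_apply]
  right_inv' := by
    rintro ⟨x, w⟩ ⟨h, -⟩
    simp only [LinearEquiv.apply_symm_apply]
    exact e.apply_mk_symm h w
  proj_toFun := fun p h => e.coe_fst' h

lemma transportPre_apply (A : SmoothVB.{u, v} I B) (V' : B → Type w) [∀ x, AddCommGroup (V' x)]
    [∀ x, Module ℝ (V' x)] (Φ : ∀ x, V' x ≃ₗ[ℝ] A.V x)
    (e : Trivialization A.F (π A.F A.V)) [e.IsLinear ℝ] (p : TotalSpace A.F V') :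
    transportPre A V' Φ e p = e ⟨p.1, Φ p.1 p.2⟩ := rfl

lemma transportPre_symm (A : SmoothVB.{u, v} I B) (V' : B → Type w) [∀ x, AddCommGroup (V' x)]
    [∀ x, Module ℝ (V' x)] (Φ : ∀ x, V' x ≃ₗ[ℝ] A.V x)
    (e : Trivialization A.F (π A.F A.V)) [e.IsLinear ℝ] {x : B} (hx : x ∈ e.baseSet) (w : A.F) :
    (transportPre A V' Φ e).symm x w = (Φ x).symm (e.symm x w) := by
  rw [Pretrivialization.symm_apply _ hx]
  rfl

/-- A family `V'` of vector spaces over `B` with fibrewise linear isomorphisms to the fibres of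
the smooth vector bundle `A` is itself a smooth vector bundle. -/
def transport (A : SmoothVB.{u, v} I B) (V' : B → Type w) [∀ x, AddCommGroup (V' x)]
    [∀ x, Module ℝ (V' x)] (Φ : ∀ x, V' x ≃ₗ[ℝ] A.V x) : SmoothVB.{u, w} I B :=
  letI top : ∀ x, TopologicalSpace (V' x) := fun x => .induced (Φ x) inferInstance
  have key : ∀ (e e' : Trivialization A.F (π A.F A.V)) [MemTrivializationAtlas e]
      [MemTrivializationAtlas e'], ∀ b ∈ e.baseSet ∩ e'.baseSet, ∀ w,
      (e.coordChangeL ℝ e' b : A.F →L[ℝ] A.F) w =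
        (transportPre A V' Φ e' ⟨b, (transportPre A V' Φ e).symm b w⟩).2 := by
    intro e e' _ _ b hb w
    rw [transportPre_apply, transportPre_symm _ _ _ _ hb.1]
    simp only [LinearEquiv.apply_symm_apply]
    exact e.coordChangeL_apply e' hb w
  letI P : VectorPrebundle ℝ A.F V' :=
    { pretrivializationAtlas := {t | ∃ (e : Trivialization A.F (π A.F A.V))
        (_ : MemTrivializationAtlas e), t = transportPre A V' Φ e}
      pretrivialization_linear' := by
        rintro _ ⟨e, he, rfl⟩
        refine ⟨fun x hx => ?_⟩
        have h := Trivialization.linear ℝ e hx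
        constructor
        · intro v w
          simp only [transportPre_apply, map_add]
          exact h.map_add _ _
        · intro c v
          simp only [transportPre_apply, map_smul]
          exact h.map_smul _ _
      pretrivializationAt := fun x => transportPre A V' Φ (trivializationAt A.F A.V x)
      mem_base_pretrivializationAt := fun x => FiberBundle.mem_baseSet_trivializationAt' x
      pretrivialization_mem_atlas := fun x => ⟨_, inferInstance, rfl⟩
      exists_coordChange := by
        rintro _ ⟨e, he, rfl⟩ _ ⟨e', he', rfl⟩
        exact ⟨_, continuousOn_coordChange ℝ e e', key e e'⟩
      totalSpaceMk_isInducing := fun x => by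
        let L : A.V x ≃L[ℝ] A.F := (trivializationAt A.F A.V x).continuousLinearEquivAt ℝ x
          (FiberBundle.mem_baseSet_trivializationAt' x)
        have h : IsInducing fun w : V' x => (x, L (Φ x w)) :=
          isInducing_const_prod.mpr (L.toHomeomorph.isInducing.comp ⟨rfl⟩)
        convert h using 1
        ext w
        · exact (trivializationAt A.F A.V x).coe_fst'
            (FiberBundle.mem_baseSet_trivializationAt' x)
        · rfl }
  haveI : P.IsContMDiff I ∞ := ⟨by
    rintro _ ⟨e, he, rfl⟩ _ ⟨e', he', rfl⟩
    exact ⟨_, contMDiffOn_coordChangeL e e', key e e'⟩⟩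
  letI := P.totalSpaceTopology
  letI := P.toFiberBundle
  haveI := P.toVectorBundle
  haveI := P.contMDiffVectorBundle (n := ∞) I
  { F := A.F
    V := V'
    tagV := fun x => topologicalAddGroup_induced (Φ x)
    smulV := fun x => continuousSMul_induced (Φ x).toLinearMap }

/-- An isomorphism of smooth vector bundles over the identity. -/
structure Iso (A : SmoothVB.{u, v} I B) (C : SmoothVB.{u, w} I B) where
  toFun : ∀ x, A.V x ≃L[ℝ] C.V x
  smooth_toFun : ContMDiff (I.prod 𝓘(ℝ, A.F)) (I.prod 𝓘(ℝ, C.F)) ∞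
    (fun p : TotalSpace A.F A.V => (⟨p.1, toFun p.1 p.2⟩ : TotalSpace C.F C.V))
  smooth_invFun : ContMDiff (I.prod 𝓘(ℝ, C.F)) (I.prod 𝓘(ℝ, A.F)) ∞
    (fun p : TotalSpace C.F C.V => (⟨p.1, (toFun p.1).symm p.2⟩ : TotalSpace A.F A.V))

end

/-- The fibres of a vector bundle are topological vector spaces. -/
lemma fibre_isTopologicalAddGroup {B : Type u} {F : Type} [TopologicalSpace B]
    [NormedAddCommGroup F] [NormedSpace ℝ F] (V : B → Type v)
    [∀ x, AddCommGroup (V x)] [∀ x, Module ℝ (V x)] [∀ x, TopologicalSpace (V x)]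
    [TopologicalSpace (TotalSpace F V)] [FiberBundle F V] [VectorBundle ℝ F V] (x : B) :
    IsTopologicalAddGroup (V x) := by
  let e := (trivializationAt F V x).continuousLinearEquivAt ℝ x
    (FiberBundle.mem_baseSet_trivializationAt' x)
  rw [e.toHomeomorph.isInducing.eq_induced]
  exact topologicalAddGroup_induced e.toLinearEquiv

/-- The fibres of a vector bundle are topological vector spaces. -/
lemma fibre_continuousSMul {B : Type u} {F : Type} [TopologicalSpace B]
    [NormedAddCommGroup F] [NormedSpace ℝ F] (V : B → Type v)
    [∀ x, AddCommGroup (V x)] [∀ x, Module ℝ (V x)] [∀ x, TopologicalSpace (V x)]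
    [TopologicalSpace (TotalSpace F V)] [FiberBundle F V] [VectorBundle ℝ F V] (x : B) :
    ContinuousSMul ℝ (V x) := by
  let e := (trivializationAt F V x).continuousLinearEquivAt ℝ x
    (FiberBundle.mem_baseSet_trivializationAt' x)
  rw [e.toHomeomorph.isInducing.eq_induced]
  exact continuousSMul_induced e.toLinearEquiv.toLinearMap

/-- Linear maps on the fibres of a vector bundle of finite rank are continuous. -/
lemma continuous_of_fibre {E H : Type} [NormedAddCommGroup E] [NormedSpace ℝ E]
    [TopologicalSpace H] {I : ModelWithCorners ℝ E H} {B : Type u} [TopologicalSpace B]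
    [ChartedSpace H B] (A : SmoothVB.{u, v} I B) [FiniteDimensional ℝ A.F] {x : B} {W : Type w}
    [AddCommGroup W] [Module ℝ W] [TopologicalSpace W] [IsTopologicalAddGroup W]
    [ContinuousSMul ℝ W] (f : A.V x →ₗ[ℝ] W) : Continuous f := by
  let e := (trivializationAt A.F A.V x).continuousLinearEquivAt ℝ x
    (FiberBundle.mem_baseSet_trivializationAt' x)
  have h : Continuous (f ∘ₗ e.symm.toLinearEquiv.toLinearMap) :=
    LinearMap.continuous_of_finiteDimensional _
  have h2 := h.comp e.continuous
  refine h2.congr fun w => ?_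
  simp

end SmoothVB

namespace LineBundle

section
variable (E : Type) [NormedAddCommGroup E] [NormedSpace ℝ E]
  {M : Type u} [TopologicalSpace M] [ChartedSpace E M]
  (L : M → Type u) [TopologicalSpace (TotalSpace ℝ L)] [∀ x, AddCommGroup (L x)]
  [∀ x, Module ℝ (L x)] [∀ x, TopologicalSpace (L x)] [FiberBundle ℝ L] [VectorBundle ℝ ℝ L]

/-- The smooth sections of the line bundle `L`. -/
abbrev Sec : Type u := ContMDiffSection 𝓘(ℝ, E) ℝ ∞ L

variable {E L}

/-- The section `s` read in the preferred local trivialization of `L` around `i`. -/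
def loc (i : M) (s : Sec E L) (y : M) : ℝ := (trivializationAt ℝ L i ⟨y, s y⟩).2

variable (E L) in
/-- The common domain of the preferred chart of `M` and the preferred trivialization of `L`
around `i`. -/
def base (i : M) : Set M := (chartAt E i).source ∩ (trivializationAt ℝ L i).baseSet

lemma isOpen_base (i : M) : IsOpen (base E L i) :=
  (chartAt E i).open_source.inter (trivializationAt ℝ L i).open_baseSet

lemma mem_base (i : M) : i ∈ base E L i :=
  ⟨mem_chart_source E i, FiberBundle.mem_baseSet_trivializationAt' i⟩

lemma loc_add {i y : M} (h : y ∈ base E L i) (s t : Sec E L) :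
    loc i (s + t) y = loc i s y + loc i t y :=
  ((trivializationAt ℝ L i).linear ℝ h.2).map_add _ _

lemma loc_smul {i y : M} (h : y ∈ base E L i) (c : ℝ) (s : Sec E L) :
    loc i (c • s) y = c * loc i s y :=
  ((trivializationAt ℝ L i).linear ℝ h.2).map_smul _ _

variable [ContMDiffVectorBundle ∞ ℝ L 𝓘(ℝ, E)]

lemma contMDiffOn_loc (i : M) (s : Sec E L) :
    ContMDiffOn 𝓘(ℝ, E) 𝓘(ℝ, ℝ) ∞ (loc i s) (base E L i) :=
  (((trivializationAt ℝ L i).contMDiffOn_section_baseSet_iff).1 s.contMDiff.contMDiffOn).mono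
    inter_subset_right

lemma mdifferentiableAt_loc {i y : M} (h : y ∈ base E L i) (s : Sec E L) :
    MDifferentiableAt 𝓘(ℝ, E) 𝓘(ℝ, ℝ) (loc i s) y :=
  ((contMDiffOn_loc i s).contMDiffAt ((isOpen_base i).mem_nhds h)).mdifferentiableAt (by simp)

/-- The section `f s`, for a smooth function `f` and a section `s`. -/
def fsmul (f : C^∞⟮𝓘(ℝ, E), M; ℝ⟯) (s : Sec E L) : Sec E L :=
  ⟨fun y => f y • s y, f.contMDiff.smul_section s.contMDiff⟩

lemma loc_fsmul {i y : M} (h : y ∈ base E L i) (f : C^∞⟮𝓘(ℝ, E), M; ℝ⟯) (s : Sec E L) :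
    loc i (fsmul f s) y = f y * loc i s y :=
  ((trivializationAt ℝ L i).linear ℝ h.2).map_smul _ _

variable (E L) in
/-- The sections of `L` vanishing to first order at `x`: both the section and its first
derivative (read in a local trivialization) vanish at `x`. -/
def vanishing (x : M) : Submodule ℝ (Sec E L) where
  carrier := {s | s x = 0 ∧ mfderiv 𝓘(ℝ, E) 𝓘(ℝ, ℝ) (loc x s) x = 0}
  zero_mem' := by
    refine ⟨rfl, ?_⟩
    have : loc x (0 : Sec E L) =ᶠ[𝓝 x] fun _ => 0 := by
      filter_upwards [(isOpen_base (E := E) (L := L) x).mem_nhds (mem_base x)] with y hy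
      simpa using loc_smul hy 0 0
    rw [this.mfderiv_eq]
    exact mfderiv_const
  add_mem' := by
    rintro s t ⟨hs, hs'⟩ ⟨ht, ht'⟩
    refine ⟨by simp [hs, ht], ?_⟩
    have : loc x (s + t) =ᶠ[𝓝 x] loc x s + loc x t := by
      filter_upwards [(isOpen_base (E := E) (L := L) x).mem_nhds (mem_base x)] with y hy
      exact loc_add hy s t
    rw [this.mfderiv_eq]
    refine (mfderiv_add (mdifferentiableAt_loc (mem_base x) s)
      (mdifferentiableAt_loc (mem_base x) t)).trans ?_
    rw [hs', ht']
    exact add_zero _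
  smul_mem' := by
    rintro c s ⟨hs, hs'⟩
    refine ⟨by simp [hs], ?_⟩
    have : loc x (c • s) =ᶠ[𝓝 x] c • loc x s := by
      filter_upwards [(isOpen_base (E := E) (L := L) x).mem_nhds (mem_base x)] with y hy
      exact loc_smul hy c s
    rw [this.mfderiv_eq]
    refine (const_smul_mfderiv (mdifferentiableAt_loc (mem_base x) s) c).trans ?_
    rw [hs']
    exact smul_zero c

variable (E L) in
/-- The space of `1`-jets at `x` of sections of `L`. -/
def Jet (x : M) : Type u := Sec E L ⧸ vanishing E L x

instance (x : M) : AddCommGroup (Jet E L x) :=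
  inferInstanceAs (AddCommGroup (Sec E L ⧸ vanishing E L x))

instance (x : M) : Module ℝ (Jet E L x) :=
  inferInstanceAs (Module ℝ (Sec E L ⧸ vanishing E L x))

/-- The `1`-jet of a section at the point `x`. -/
def jet (x : M) : Sec E L →ₗ[ℝ] Jet E L x := (vanishing E L x).mkQ

/-- `Δ` satisfies the Leibniz rule at the point `x`, with symbol `v`. -/
def HasSymbol {x : M} (Δ : Sec E L →ₗ[ℝ] L x) (v : TangentSpace 𝓘(ℝ, E) x) : Prop :=
  ∀ (f : C^∞⟮𝓘(ℝ, E), M; ℝ⟯) (s : Sec E L),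
    Δ (fsmul f s) = (show ℝ from mfderiv 𝓘(ℝ, E) 𝓘(ℝ, ℝ) f x v) • s x + f x • Δ s

variable (E L) in
/-- The space of derivations of `L` at `x`: linear maps `Γ(L) → L_x` satisfying the Leibniz
rule for some tangent vector at `x`. -/
def Der (x : M) : Submodule ℝ (Sec E L →ₗ[ℝ] L x) where
  carrier := {Δ | ∃ v, HasSymbol Δ v}
  zero_mem' := ⟨0, fun f s => by
    rw [(mfderiv 𝓘(ℝ, E) 𝓘(ℝ, ℝ) f x).map_zero]
    exact (by simp : (0 : L x) = (0 : ℝ) • s x + f x • 0)⟩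
  add_mem' := by
    rintro Δ Δ' ⟨v, hv⟩ ⟨v', hv'⟩
    refine ⟨v + v', fun f s => ?_⟩
    rw [(mfderiv 𝓘(ℝ, E) 𝓘(ℝ, ℝ) f x).map_add]
    refine (congrArg₂ (· + ·) (hv f s) (hv' f s)).trans ?_
    simp only [LinearMap.add_apply, smul_add]
    refine Eq.trans ?_ (congrArg (· + _) (add_smul _ _ _).symm)
    abel
  smul_mem' := by
    rintro c Δ ⟨v, hv⟩
    refine ⟨c • v, fun f s => ?_⟩
    rw [(mfderiv 𝓘(ℝ, E) 𝓘(ℝ, ℝ) f x).map_smul]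
    refine (congrArg (c • ·) (hv f s)).trans ?_
    simp only [LinearMap.smul_apply, smul_add]
    rw [smul_comm (f x) c]
    refine congrArg (· + _) ?_
    exact (mul_smul _ _ _).symm


variable (E L) in
/-- The transition function between the preferred local trivializations of `L` around `i`
and `j`. -/
def trans (i j x : M) : ℝ :=
  (trivializationAt ℝ L i).coordChangeL ℝ (trivializationAt ℝ L j) x 1

lemma contMDiffOn_trans (i j : M) :
    ContMDiffOn 𝓘(ℝ, E) 𝓘(ℝ, ℝ) ∞ (trans L i j) (base E L i ∩ base E L j) := by
  have h := contMDiffOn_coordChangeL (IB := 𝓘(ℝ, E)) (n := ∞) (trivializationAt ℝ L i)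
    (trivializationAt ℝ L j)
  exact (h.clm_apply contMDiffOn_const).mono fun x hx => ⟨hx.1.2, hx.2.2⟩

lemma loc_trans {i j y : M} (hi : y ∈ base E L i) (hj : y ∈ base E L j) (s : Sec E L) :
    loc j s y = trans L i j y * loc i s y := by
  have h := (trivializationAt ℝ L i).coordChangeL_apply (R := ℝ) (trivializationAt ℝ L j)
    ⟨hi.2, hj.2⟩ (loc i s y)
  have h2 : (trivializationAt ℝ L i).symm y (loc i s y) = s y :=
    (trivializationAt ℝ L i).symm_apply_apply_mk hi.2 (s y)
  rw [h2] at h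
  rw [loc, ← h, trans, mul_comm, ← smul_eq_mul, ← map_smul, smul_eq_mul, mul_one]

/-- The value of a derivation `Δ` at `x` on a section `s`. -/
def derApply {x : M} (Δ : Der E L x) (s : Sec E L) : L x := Δ.1 s

variable [IsManifold 𝓘(ℝ, E) ∞ M]

/-- The derivative at `φ i x` of `h` read in the chart `φ i` depends smoothly on `x`. -/
lemma contMDiffOn_fderiv {G : Type} [NormedAddCommGroup G] [NormedSpace ℝ G] {h : M → G} {i : M}
    {U : Set M} (hU : IsOpen U) (hUi : U ⊆ (chartAt E i).source)
    (hh : ContMDiffOn 𝓘(ℝ, E) 𝓘(ℝ, G) ∞ h U) :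
    ContMDiffOn 𝓘(ℝ, E) 𝓘(ℝ, E →L[ℝ] G) ∞
      (fun x => fderiv ℝ (h ∘ (chartAt E i).symm) (chartAt E i x)) U := by
  have hV : IsOpen ((chartAt E i).target ∩ (chartAt E i).symm ⁻¹' U) :=
    (chartAt E i).isOpen_inter_preimage_symm hU
  have h1 : ContMDiffOn 𝓘(ℝ, E) 𝓘(ℝ, G) ∞ (h ∘ (chartAt E i).symm)
      ((chartAt E i).target ∩ (chartAt E i).symm ⁻¹' U) :=
    hh.comp ((contMDiffOn_chart_symm (I := 𝓘(ℝ, E)) (x := i)).mono inter_subset_left)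
      fun y hy => hy.2
  have h2 := (h1.contDiffOn.fderiv_of_isOpen hV (m := ∞) (by simp)).contMDiffOn
  refine h2.comp ((contMDiffOn_chart (I := 𝓘(ℝ, E)) (x := i)).mono hUi) fun y hy => ?_
  refine ⟨(chartAt E i).map_source (hUi hy), ?_⟩
  simpa [(chartAt E i).left_inv (hUi hy)] using hy

lemma differentiableAt_comp_symm {G : Type} [NormedAddCommGroup G] [NormedSpace ℝ G] {h : M → G}
    {i x : M} {U : Set M} (hU : IsOpen U) (hxi : x ∈ (chartAt E i).source) (hx : x ∈ U)
    (hh : ContMDiffOn 𝓘(ℝ, E) 𝓘(ℝ, G) ∞ h U) :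
    DifferentiableAt ℝ (h ∘ (chartAt E i).symm) (chartAt E i x) := by
  have h1 : ContMDiffAt 𝓘(ℝ, E) 𝓘(ℝ, G) ∞ h ((chartAt E i).symm (chartAt E i x)) := by
    rw [(chartAt E i).left_inv hxi]
    exact hh.contMDiffAt (hU.mem_nhds hx)
  have h2 : ContMDiffAt 𝓘(ℝ, E) 𝓘(ℝ, E) ∞ (chartAt E i).symm (chartAt E i x) :=
    (contMDiffOn_chart_symm (I := 𝓘(ℝ, E)) (x := i)).contMDiffAt
      ((chartAt E i).open_target.mem_nhds ((chartAt E i).map_source hxi))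
  exact (h1.comp _ h2).contDiffAt.differentiableAt (by simp)

/-- The `1`-jet at `x` of a section in the local coordinates around `i`: value and derivative. -/
def jetC (i x : M) (s : Sec E L) : ℝ × (E →L[ℝ] ℝ) :=
  (loc i s x, fderiv ℝ (loc i s ∘ (chartAt E i).symm) (chartAt E i x))

lemma eventually_symm {i x : M} (hxi : x ∈ (chartAt E i).source) {p : M → Prop}
    (hp : ∀ᶠ y in 𝓝 x, p y) : ∀ᶠ z in 𝓝 (chartAt E i x), p ((chartAt E i).symm z) := by
  have h := (chartAt E i).continuousAt_symm ((chartAt E i).map_source hxi)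
  rw [ContinuousAt, (chartAt E i).left_inv hxi] at h
  exact h.eventually hp

lemma jetC_add {i x : M} (hx : x ∈ base E L i) (s t : Sec E L) :
    jetC i x (s + t) = jetC i x s + jetC i x t := by
  refine Prod.ext (loc_add hx s t) ?_
  have h1 : loc i (s + t) ∘ (chartAt E i).symm =ᶠ[𝓝 (chartAt E i x)]
      (loc i s ∘ (chartAt E i).symm) + (loc i t ∘ (chartAt E i).symm) :=
    eventually_symm hx.1 (p := fun y => loc i (s + t) y = loc i s y + loc i t y) <| by
      filter_upwards [(isOpen_base i).mem_nhds hx] with y hy using loc_add hy s t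
  refine h1.fderiv_eq.trans ?_
  exact fderiv_add (differentiableAt_comp_symm (isOpen_base i) hx.1 hx (contMDiffOn_loc i s))
    (differentiableAt_comp_symm (isOpen_base i) hx.1 hx (contMDiffOn_loc i t))

lemma jetC_smul {i x : M} (hx : x ∈ base E L i) (c : ℝ) (s : Sec E L) :
    jetC i x (c • s) = c • jetC i x s := by
  refine Prod.ext (loc_smul hx c s) ?_
  have h1 : loc i (c • s) ∘ (chartAt E i).symm =ᶠ[𝓝 (chartAt E i x)]
      c • (loc i s ∘ (chartAt E i).symm) :=
    eventually_symm hx.1 (p := fun y => loc i (c • s) y = c * loc i s y) <| by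
      filter_upwards [(isOpen_base i).mem_nhds hx] with y hy using loc_smul hy c s
  refine h1.fderiv_eq.trans ?_
  exact fderiv_const_smul
    (differentiableAt_comp_symm (isOpen_base i) hx.1 hx (contMDiffOn_loc i s)) c

/-- `jetC` as a linear map. -/
def jetL {i x : M} (hx : x ∈ base E L i) : Sec E L →ₗ[ℝ] ℝ × (E →L[ℝ] ℝ) where
  toFun := jetC i x
  map_add' := jetC_add hx
  map_smul' := jetC_smul hx

lemma jetC_fsmul {i x : M} (hx : x ∈ base E L i) (f : C^∞⟮𝓘(ℝ, E), M; ℝ⟯) (s : Sec E L) :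
    jetC i x (fsmul f s) = f x • jetC i x s +
      (0, loc i s x • fderiv ℝ (f ∘ (chartAt E i).symm) (chartAt E i x)) := by
  refine Prod.ext ((loc_fsmul hx f s).trans (by simp [jetC])) ?_
  have h1 : loc i (fsmul f s) ∘ (chartAt E i).symm =ᶠ[𝓝 (chartAt E i x)]
      (f ∘ (chartAt E i).symm) * (loc i s ∘ (chartAt E i).symm) :=
    eventually_symm hx.1 (p := fun y => loc i (fsmul f s) y = f y * loc i s y) <| by
      filter_upwards [(isOpen_base i).mem_nhds hx] with y hy using loc_fsmul hy f s
  refine h1.fderiv_eq.trans ?_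
  refine (fderiv_mul (differentiableAt_comp_symm isOpen_univ hx.1 (mem_univ _)
    f.contMDiff.contMDiffOn)
    (differentiableAt_comp_symm (isOpen_base i) hx.1 hx (contMDiffOn_loc i s))).trans ?_
  simp [jetC, (chartAt E i).left_inv hx.1]

variable (E L) in
/-- The change of local coordinates on `1`-jets. -/
def jetChange (i j x : M) : (ℝ × (E →L[ℝ] ℝ)) →L[ℝ] (ℝ × (E →L[ℝ] ℝ)) :=
  trans L i j x • (ContinuousLinearMap.inl ℝ ℝ (E →L[ℝ] ℝ)).comp
      (ContinuousLinearMap.fst ℝ ℝ (E →L[ℝ] ℝ)) +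
  (ContinuousLinearMap.inr ℝ ℝ (E →L[ℝ] ℝ)).comp
    ((ContinuousLinearMap.smulRightL ℝ _ _ (ContinuousLinearMap.fst ℝ ℝ (E →L[ℝ] ℝ)))
      (fderiv ℝ (trans L i j ∘ (chartAt E j).symm) (chartAt E j x))) +
  trans L i j x • (ContinuousLinearMap.inr ℝ ℝ (E →L[ℝ] ℝ)).comp
    (((ContinuousLinearMap.compL ℝ E E ℝ).flip
      (fderiv ℝ (chartAt E i ∘ (chartAt E j).symm) (chartAt E j x))).comp
        (ContinuousLinearMap.snd ℝ ℝ (E →L[ℝ] ℝ)))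

lemma jetChange_apply (i j x : M) (b : ℝ) (α : E →L[ℝ] ℝ) :
    jetChange E L i j x (b, α) = (trans L i j x * b,
      b • fderiv ℝ (trans L i j ∘ (chartAt E j).symm) (chartAt E j x) +
      trans L i j x • α.comp (fderiv ℝ (chartAt E i ∘ (chartAt E j).symm) (chartAt E j x))) := by
  simp [jetChange]

lemma contMDiffOn_jetChange (i j : M) :
    ContMDiffOn 𝓘(ℝ, E) 𝓘(ℝ, (ℝ × (E →L[ℝ] ℝ)) →L[ℝ] (ℝ × (E →L[ℝ] ℝ))) ∞ (jetChange E L i j)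
      (base E L i ∩ base E L j) := by
  have hU := (isOpen_base (E := E) (L := L) i).inter (isOpen_base (E := E) (L := L) j)
  have h1 := contMDiffOn_trans (E := E) (L := L) i j
  have h2 := contMDiffOn_fderiv hU (fun x hx => hx.2.1) h1
  have h3 : ContMDiffOn 𝓘(ℝ, E) 𝓘(ℝ, E →L[ℝ] E) ∞
      (fun x => fderiv ℝ (chartAt E i ∘ (chartAt E j).symm) (chartAt E j x))
      (base E L i ∩ base E L j) := contMDiffOn_fderiv hU (fun x hx => hx.2.1)
    ((contMDiffOn_chart (I := 𝓘(ℝ, E)) (x := i)).mono fun x hx => hx.1.1)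
  refine ((h1.smul contMDiffOn_const).add (contMDiffOn_const.clm_comp
    (contMDiffOn_const.clm_apply h2))).add (h1.smul (contMDiffOn_const.clm_comp
    ((contMDiffOn_const.clm_apply h3).clm_comp contMDiffOn_const)))

lemma jetChange_jetC {i j x : M} (hi : x ∈ base E L i) (hj : x ∈ base E L j) (s : Sec E L) :
    jetChange E L i j x (jetC i x s) = jetC j x s := by
  have hU := (isOpen_base (E := E) (L := L) i).inter (isOpen_base (E := E) (L := L) j)
  rw [jetC, jetChange_apply]
  refine Prod.ext (loc_trans hi hj s).symm (Eq.symm ?_)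
  have h1 : loc j s ∘ (chartAt E j).symm =ᶠ[𝓝 (chartAt E j x)]
      (trans L i j ∘ (chartAt E j).symm) *
        ((loc i s ∘ (chartAt E i).symm) ∘ (chartAt E i ∘ (chartAt E j).symm)) :=
    eventually_symm hj.1 (p := fun y => loc j s y = trans L i j y *
      loc i s ((chartAt E i).symm (chartAt E i y))) <| by
      filter_upwards [hU.mem_nhds ⟨hi, hj⟩] with y hy
      rw [(chartAt E i).left_inv hy.1.1]
      exact loc_trans hy.1 hy.2 s
  have d1 := differentiableAt_comp_symm hU hj.1 ⟨hi, hj⟩ (contMDiffOn_trans (E := E) (L := L) i j)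
  have d2 : DifferentiableAt ℝ (chartAt E i ∘ (chartAt E j).symm) (chartAt E j x) :=
    differentiableAt_comp_symm (chartAt E i).open_source hj.1 hi.1
      (contMDiffOn_chart (I := 𝓘(ℝ, E)) (x := i))
  have e : (chartAt E i ∘ (chartAt E j).symm) (chartAt E j x) = chartAt E i x := by
    simp [(chartAt E j).left_inv hj.1]
  have d3 : DifferentiableAt ℝ (loc i s ∘ (chartAt E i).symm)
      ((chartAt E i ∘ (chartAt E j).symm) (chartAt E j x)) := by
    rw [e]
    exact differentiableAt_comp_symm (isOpen_base i) hi.1 hi (contMDiffOn_loc i s)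
  refine h1.fderiv_eq.trans ((fderiv_mul d1 (d3.comp _ d2)).trans ?_)
  rw [fderiv_comp _ d3 d2, e]
  simp only [Function.comp_apply, (chartAt E j).left_inv hj.1, (chartAt E i).left_inv hi.1]
  exact add_comm _ _


lemma mfderiv_eq_fderiv {G : Type} [NormedAddCommGroup G] [NormedSpace ℝ G] {h : M → G} {x : M}
    (hh : MDifferentiableAt 𝓘(ℝ, E) 𝓘(ℝ, G) h x) :
    mfderiv 𝓘(ℝ, E) 𝓘(ℝ, G) h x = fderiv ℝ (h ∘ (chartAt E x).symm) (chartAt E x x) := by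
  refine hh.mfderiv.trans ?_
  simp only [writtenInExtChartAt, extChartAt, OpenPartialHomeomorph.extend, modelWithCornersSelf_partialEquiv,
    PartialEquiv.trans_refl, modelWithCornersSelf_coe, range_id, fderivWithin_univ]
  rfl

lemma mem_vanishing_iff {x : M} (s : Sec E L) : s ∈ vanishing E L x ↔ jetC x x s = 0 := by
  have h0 : s x = 0 ↔ loc x s x = 0 := by
    have h := (trivializationAt ℝ L x).continuousLinearEquivAt ℝ x (mem_base (E := E) x).2
    exact (((trivializationAt ℝ L x).continuousLinearEquivAt ℝ x
      (mem_base (E := E) x).2).map_eq_zero_iff (x := s x)).symm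
  change (s x = 0 ∧ mfderiv 𝓘(ℝ, E) 𝓘(ℝ, ℝ) (loc x s) x = 0) ↔ _
  rw [h0, jetC, Prod.mk_eq_zero, mfderiv_eq_fderiv (mdifferentiableAt_loc (mem_base x) s)]
  exact Iff.rfl

variable [FiniteDimensional ℝ E] [T2Space M]

lemma exists_bump {x : M} {U : Set M} (hU : IsOpen U) (hx : x ∈ U) :
    ∃ χ : C^∞⟮𝓘(ℝ, E), M; ℝ⟯, (∀ᶠ y in 𝓝 x, χ y = 1) ∧ tsupport χ ⊆ U := by
  obtain ⟨f, -, hf⟩ := (SmoothBumpFunction.nhds_basis_tsupport (I := 𝓘(ℝ, E)) x).mem_iff.1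
    (hU.mem_nhds hx)
  exact ⟨⟨f, f.contMDiff⟩, f.eventuallyEq_one, hf⟩

/-- The section `χ · h · e`, where `e` is the preferred local frame of `L` around `i` and `χ` is
a cut-off function. -/
def cutSec (i : M) (χ : C^∞⟮𝓘(ℝ, E), M; ℝ⟯) (hχ : tsupport χ ⊆ base E L i) (h : M → ℝ)
    (hh : ContMDiffOn 𝓘(ℝ, E) 𝓘(ℝ, ℝ) ∞ h (base E L i)) : Sec E L :=
  ⟨fun y => χ y • (trivializationAt ℝ L i).symm y (h y), by
    refine ContMDiffOn.smul_section_of_tsupport (u := base E L i) χ.contMDiff.contMDiffOn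
      (isOpen_base i) hχ ?_
    refine ((trivializationAt ℝ L i).contMDiffOn_section_iff
      (IB := 𝓘(ℝ, E)) (isOpen_base i) inter_subset_right).2 ?_
    refine hh.congr fun y hy => ?_
    rw [(trivializationAt ℝ L i).apply_mk_symm hy.2]⟩

lemma loc_cutSec {i y : M} (hy : y ∈ base E L i) (χ : C^∞⟮𝓘(ℝ, E), M; ℝ⟯)
    (hχ : tsupport χ ⊆ base E L i) (h : M → ℝ)
    (hh : ContMDiffOn 𝓘(ℝ, E) 𝓘(ℝ, ℝ) ∞ h (base E L i)) :
    loc i (cutSec i χ hχ h hh) y = χ y * h y := by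
  refine (((trivializationAt ℝ L i).linear ℝ hy.2).map_smul _ _).trans ?_
  rw [(trivializationAt ℝ L i).apply_mk_symm hy.2]
  rfl

lemma jetC_surjective {i x : M} (hx : x ∈ base E L i) :
    Function.Surjective (jetC (L := L) (E := E) i x) := by
  rintro ⟨b, α⟩
  obtain ⟨χ, h1, hχ⟩ := exists_bump (E := E) (isOpen_base (E := E) (L := L) i) hx
  have hh : ContMDiffOn 𝓘(ℝ, E) 𝓘(ℝ, ℝ) ∞ (fun y => b + α (chartAt E i y - chartAt E i x))
      (base E L i) := by
    refine contMDiffOn_const.add (contMDiffOn_const.clm_apply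
      (ContMDiffOn.sub ?_ contMDiffOn_const))
    exact (contMDiffOn_chart (I := 𝓘(ℝ, E)) (x := i)).mono inter_subset_left
  refine ⟨cutSec i χ hχ _ hh, Prod.ext ?_ ?_⟩
  · simp [jetC, loc_cutSec hx, h1.self_of_nhds]
  · have e : loc i (cutSec i χ hχ _ hh) ∘ (chartAt E i).symm =ᶠ[𝓝 (chartAt E i x)]
        fun z => b + α (z - chartAt E i x) := by
      have := eventually_symm hx.1 (p := fun y => loc i (cutSec i χ hχ _ hh) y =
          b + α (chartAt E i y - chartAt E i x)) <| by
        filter_upwards [(isOpen_base (E := E) (L := L) i).mem_nhds hx, h1] with y hy hy1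
        rw [loc_cutSec hy, hy1, one_mul]
      filter_upwards [this, (chartAt E i).open_target.mem_nhds
        ((chartAt E i).map_source hx.1)] with z hz hz'
      rw [Function.comp_apply, hz, (chartAt E i).right_inv hz']
    refine e.fderiv_eq.trans ?_
    rw [fderiv_const_add]
    have : HasFDerivAt (fun z => α (z - chartAt E i x)) (α.comp (.id ℝ E)) (chartAt E i x) :=
      α.hasFDerivAt.comp _ ((hasFDerivAt_id _).sub_const _)
    simpa using this.fderiv

variable (E L) in
/-- The vector bundle with fibre `ℝ × E*` and the transition functions of `1`-jets. -/
def jetCore : VectorBundleCore ℝ M (ℝ × (E →L[ℝ] ℝ)) M where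
  baseSet := base E L
  isOpen_baseSet := isOpen_base
  indexAt := id
  mem_baseSet_at := mem_base
  coordChange := jetChange E L
  coordChange_self i x hx v := by
    obtain ⟨s, rfl⟩ := jetC_surjective hx v
    exact jetChange_jetC hx hx s
  continuousOn_coordChange i j := (contMDiffOn_jetChange i j).continuousOn
  coordChange_comp i j k x hx v := by
    obtain ⟨s, rfl⟩ := jetC_surjective hx.1.1 v
    rw [jetChange_jetC hx.1.1 hx.1.2, jetChange_jetC hx.1.2 hx.2, jetChange_jetC hx.1.1 hx.2]

instance : (jetCore E L).IsContMDiff 𝓘(ℝ, E) ∞ := ⟨contMDiffOn_jetChange⟩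

variable (E L) in
/-- The bundle with core `jetCore`. -/
def jetModel : SmoothVB.{u, 0} 𝓘(ℝ, E) M where
  F := ℝ × (E →L[ℝ] ℝ)
  V := (jetCore E L).Fiber
  tagV := fun _ => inferInstanceAs (IsTopologicalAddGroup (ℝ × (E →L[ℝ] ℝ)))
  smulV := fun _ => inferInstanceAs (ContinuousSMul ℝ (ℝ × (E →L[ℝ] ℝ)))

lemma vanishing_eq_ker (x : M) :
    vanishing E L x = LinearMap.ker (jetL (L := L) (mem_base (E := E) x)) := by
  ext s
  exact mem_vanishing_iff s

variable (E L) in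
/-- A `1`-jet at `x` in the local coordinates around `x`. -/
def jetEquiv (x : M) : Jet E L x ≃ₗ[ℝ] (jetModel E L).V x :=
  (Submodule.quotEquivOfEq _ _ (vanishing_eq_ker x)).trans
    ((jetL (L := L) (mem_base (E := E) x)).quotKerEquivOfSurjective
      (jetC_surjective (mem_base x)))

variable (E L) in
/-- The first jet bundle `J¹L`, with fibres `Jet E L x`. -/
def jetBundle : SmoothVB.{u, u} 𝓘(ℝ, E) M :=
  (jetModel E L).transport (Jet E L) (jetEquiv E L)


variable (E L) in
/-- The line bundle `L` itself. -/
def lineVB : SmoothVB.{u, u} 𝓘(ℝ, E) M where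
  F := ℝ
  V := L
  tagV := SmoothVB.fibre_isTopologicalAddGroup (F := ℝ) L
  smulV := SmoothVB.fibre_continuousSMul (F := ℝ) L

instance : FiniteDimensional ℝ (jetBundle E L).F :=
  inferInstanceAs (FiniteDimensional ℝ (ℝ × (E →L[ℝ] ℝ)))

variable (E L) in
lemma exists_vector (ξ : (E →L[ℝ] ℝ) →ₗ[ℝ] ℝ) : ∃ v : E, ∀ α, ξ α = α v := by
  obtain ⟨v, hv⟩ := (Module.evalEquiv ℝ E).surjective
    (ξ ∘ₗ (LinearMap.toContinuousLinearMap (𝕜 := ℝ) (E := E) (F' := ℝ)).toLinearMap)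
  refine ⟨v, fun α => ?_⟩
  have h := LinearMap.congr_fun hv α.toLinearMap
  exact h.symm

lemma hom_hasSymbol {x : M} (A : Jet E L x →ₗ[ℝ] L x) :
    ∃ v, HasSymbol (A ∘ₗ jet x) v := by
  have hx := mem_base (E := E) (L := L) x
  let e := ((trivializationAt ℝ L x).continuousLinearEquivAt ℝ x hx.2).toLinearEquiv
  let A' : (ℝ × (E →L[ℝ] ℝ)) →ₗ[ℝ] L x := A ∘ₗ (jetEquiv E L x).symm.toLinearMap
  have hA' : ∀ s, A (jet x s) = A' (jetC x x s) := fun s =>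
    congrArg A ((jetEquiv E L x).symm_apply_apply (jet x s)).symm
  obtain ⟨v, hv⟩ := exists_vector E
    (e.toLinearMap ∘ₗ A' ∘ₗ LinearMap.inr ℝ ℝ (E →L[ℝ] ℝ))
  refine ⟨v, fun f s => ?_⟩
  have h1 : A' (0, loc x s x • fderiv ℝ (f ∘ (chartAt E x).symm) (chartAt E x x)) =
      (fderiv ℝ (f ∘ (chartAt E x).symm) (chartAt E x x) v) • s x := by
    apply e.injective
    refine (hv _).trans ?_
    refine Eq.trans ?_ (map_smul e _ _).symm
    exact mul_comm _ _
  simp only [LinearMap.comp_apply]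
  rw [hA', hA', jetC_fsmul hx, map_add, map_smul, h1, add_comm,
    mfderiv_eq_fderiv (f.contMDiff.mdifferentiableAt (by simp))]
  rfl

lemma der_vanishing {x : M} {Δ : Sec E L →ₗ[ℝ] L x} {v : TangentSpace 𝓘(ℝ, E) x}
    (hΔ : HasSymbol Δ v) {s : Sec E L} (hs : s ∈ vanishing E L x) : Δ s = 0 := by
  obtain ⟨hs0, hs1⟩ := hs
  obtain ⟨χ, h1, hχ⟩ := exists_bump (E := E) (isOpen_base (E := E) (L := L) x) (mem_base x)
  have hu : ContMDiff 𝓘(ℝ, E) 𝓘(ℝ, ℝ) ∞ (fun y => χ y * loc x s y) := by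
    refine contMDiff_of_tsupport fun y hy => ?_
    have hy' : y ∈ base E L x := hχ (tsupport_mul_subset_left hy)
    exact χ.contMDiff.contMDiffAt.mul
      ((contMDiffOn_loc x s).contMDiffAt ((isOpen_base x).mem_nhds hy'))
  let f : C^∞⟮𝓘(ℝ, E), M; ℝ⟯ := ⟨_, hu⟩
  have hfs : fsmul f (cutSec x χ hχ (fun _ => 1) contMDiffOn_const) = fsmul (χ * χ) s := by
    ext y
    by_cases hy : y ∈ base E L x
    · have h2 : (trivializationAt ℝ L x).symm y (loc x s y) = s y :=
        (trivializationAt ℝ L x).symm_apply_apply_mk hy.2 (s y)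
      have h3 : loc x s y • (trivializationAt ℝ L x).symm y 1 = s y := by
        have h4 : (trivializationAt ℝ L x).symm y (loc x s y • 1) =
            loc x s y • (trivializationAt ℝ L x).symm y 1 :=
          by simpa only [Trivialization.coe_symmₗ (hb := hy.2)] using
            ((trivializationAt ℝ L x).symmₗ ℝ y).map_smul (loc x s y) 1
        rw [smul_eq_mul, mul_one] at h4
        exact h4.symm.trans h2
      change (χ y * loc x s y) • χ y • (trivializationAt ℝ L x).symm y 1 = (χ y * χ y) • s y
      rw [← h3, smul_smul, smul_smul]
      congr 1
      ring
    · have h0 : χ y = 0 := image_eq_zero_of_notMem_tsupport fun h => hy (hχ h)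
      change (χ y * loc x s y) • _ = (χ y * χ y) • s y
      simp [h0]
  have e1 := hΔ f (cutSec x χ hχ (fun _ => 1) contMDiffOn_const)
  have e2 := hΔ (χ * χ) s
  have hloc : loc x s x = 0 := by
    have := ((trivializationAt ℝ L x).continuousLinearEquivAt ℝ x
      (mem_base (E := E) x).2).map_zero
    rw [← hs0] at this
    exact this
  have hf0 : f x = 0 := by
    change χ x * loc x s x = 0
    rw [hloc, mul_zero]
  have hf1 : mfderiv 𝓘(ℝ, E) 𝓘(ℝ, ℝ) f x = 0 := by
    have : (f : M → ℝ) =ᶠ[𝓝 x] loc x s := by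
      filter_upwards [h1] with y hy
      change χ y * loc x s y = _
      rw [hy, one_mul]
    rw [this.mfderiv_eq]
    exact hs1
  have hχx : (χ * χ) x = 1 := by
    change χ x * χ x = 1
    rw [h1.self_of_nhds, one_mul]
  rw [hfs, e2, hs0, hχx, hf0, hf1, smul_zero, zero_add, one_smul, zero_smul, add_zero] at e1
  exact e1.trans (zero_smul ℝ _)

variable (E L) in
/-- Composition with `jet x`, as a map from `Hom(J¹L, L)` at `x` to derivations at `x`. -/
def homToDer (x : M) : ((jetBundle E L).V x →L[ℝ] (lineVB E L).V x) →ₗ[ℝ] Der E L x where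
  toFun A := ⟨(show Jet E L x →ₗ[ℝ] L x from A.toLinearMap) ∘ₗ jet x, hom_hasSymbol _⟩
  map_add' _ _ := rfl
  map_smul' _ _ := rfl

lemma homToDer_bijective (x : M) : Function.Bijective (homToDer E L x) := by
  constructor
  · intro A A' h
    ext j
    obtain ⟨s, rfl⟩ := (vanishing E L x).mkQ_surjective j
    exact LinearMap.congr_fun (congrArg Subtype.val h) s
  · rintro ⟨Δ, v, hv⟩
    let A : (jetBundle E L).V x →ₗ[ℝ] (lineVB E L).V x :=
      (vanishing E L x).liftQ Δ fun s hs => der_vanishing hv hs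
    exact ⟨⟨A, SmoothVB.continuous_of_fibre _ A⟩, rfl⟩

variable (E L) in
/-- The gauge algebroid `DL`, with fibres `Der E L x`, as a vector bundle. -/
def derBundle : SmoothVB.{u, u} 𝓘(ℝ, E) M :=
  ((jetBundle E L).hom (lineVB E L)).transport (fun x => Der E L x)
    fun x => (LinearEquiv.ofBijective (homToDer E L x) (homToDer_bijective x)).symm

variable (E L) in
/-- The bundle of Atiyah `(l, m)`-tensors: maps `DL × ⋯ × DL × J¹L × ⋯ × J¹L → L`
(with `l` factors `DL` and `m` factors `J¹L`) linear in each argument. -/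
def atiyah (l m : ℕ) : SmoothVB.{u, u} 𝓘(ℝ, E) M :=
  (derBundle E L).multi ((jetBundle E L).multi (lineVB E L) m) l


variable (L) in
/-- The fibres of the dual line bundle `L*`. -/
abbrev Dual (x : M) : Type u := L x →L[ℝ] Bundle.Trivial M ℝ x

variable (L) in
/-- The total space of the dual line bundle `L*`. -/
abbrev DualTotal : Type u := TotalSpace (ℝ →L[ℝ] ℝ) (Dual L)

variable (L) in
/-- The slit dual `L* ∖ 0`: the total space of `L*` with the zero section removed, as an open
submanifold of `L*`. -/
def slitDual : TopologicalSpace.Opens (DualTotal L) where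
  carrier := {ε | ε.2 ≠ 0}
  is_open' := by
    rw [isOpen_iff_mem_nhds]
    intro ε hε
    let e := trivializationAt (ℝ →L[ℝ] ℝ) (Dual L) ε.1
    have hU : IsOpen (e.source ∩ e ⁻¹' (univ ×ˢ {0}ᶜ)) :=
      e.continuousOn_toFun.isOpen_inter_preimage e.open_source
        (isOpen_univ.prod isOpen_compl_singleton)
    have key : ∀ η : DualTotal L, η ∈ e.source → ((e η).2 = 0 ↔ η.2 = 0) := by
      intro η hη
      have hb : η.1 ∈ e.baseSet := e.mem_source.1 hη
      exact (e.continuousLinearEquivAt ℝ η.1 hb).map_eq_zero_iff (x := η.2)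
    have hsrc : ε ∈ e.source :=
      e.mem_source.2 (FiberBundle.mem_baseSet_trivializationAt' ε.1)
    refine Filter.mem_of_superset (hU.mem_nhds ⟨hsrc, mem_univ _, ?_⟩) ?_
    · exact fun h => hε ((key ε hsrc).1 h)
    · rintro η ⟨hη, -, h⟩
      exact fun h0 => h ((key η hη).2 h0)

variable (E) in
/-- The model with corners of the manifold `L*`, hence of `L* ∖ 0`. -/
abbrev slitModel : ModelWithCorners ℝ (E × (ℝ →L[ℝ] ℝ)) (ModelProd E (ℝ →L[ℝ] ℝ)) :=
  𝓘(ℝ, E).prod 𝓘(ℝ, ℝ →L[ℝ] ℝ)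

variable (E L) in
/-- The bundle projection `p : L* ∖ 0 → M`. -/
def proj : ContMDiffMap (slitModel E) 𝓘(ℝ, E) (slitDual L) M ∞ :=
  ⟨fun ε => ε.1.1, (Bundle.contMDiff_proj (Dual L)).comp contMDiff_subtype_val⟩

/-- The action `h_r` of a non-zero real number `r` on `L* ∖ 0`. -/
def scale (r : ℝˣ) (ε : slitDual L) : slitDual L :=
  ⟨⟨ε.1.1, (r : ℝ) • ε.1.2⟩, smul_ne_zero r.ne_zero ε.2⟩

/-- The homogenization of a section `s` of `L`: the function `ε ↦ ⟨ε, s⟩` on `L* ∖ 0`. -/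
def homogenize (s : Sec E L) (ε : slitDual L) : ℝ := ε.1.2 (s ε.1.1)

variable (E L) in
/-- The bundle of `(l, m)`-tensors on `L* ∖ 0`: maps
`T × ⋯ × T × T* × ⋯ × T* → ℝ` (with `l` tangent and `m` cotangent factors) linear in each
argument. -/
def tensors (l m : ℕ) : SmoothVB.{u, 0} (slitModel E) (slitDual L) :=
  (SmoothVB.tangent _ _).multi
    ((SmoothVB.cotangent _ _).multi (SmoothVB.trivialLine _ _) m) l

variable (E L) in
/-- The value of an `(l, m)`-tensor on `l` tangent vectors and `m` covectors at a point. -/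
def tensorEval (l m : ℕ) {ε : slitDual L} (T : (tensors E L l m).V ε)
    (v : Fin l → TangentSpace (slitModel E) ε)
    (θ : Fin m → (TangentSpace (slitModel E) ε →L[ℝ] ℝ)) : ℝ :=
  SmoothVB.eval (SmoothVB.cotangent (slitModel E) (slitDual L)) (SmoothVB.trivialLine _ _) m
    (SmoothVB.eval (SmoothVB.tangent _ _) _ l T v) θ

variable (E L) in
/-- The value of an Atiyah `(l, m)`-tensor on `l` derivations and `m` jets at a point. -/
def atiyahEval (l m : ℕ) {x : M} (T : (atiyah E L l m).V x)
    (Δ : Fin l → Der E L x) (ψ : Fin m → Jet E L x) : L x :=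
  SmoothVB.eval (jetBundle E L) (lineVB E L) m
    (SmoothVB.eval (derBundle E L) _ l T Δ) ψ

variable (E L) in
/-- The differential of `h_r`. -/
def dscale (r : ℝˣ) (ε : slitDual L) :
    TangentSpace (slitModel E) ε →L[ℝ] TangentSpace (slitModel E) (scale r ε) :=
  mfderiv (slitModel E) (slitModel E) (scale r) ε

/-- `𝒮 = h_r^* 𝒯`: the tensors agree after pushing vectors forward along the diffeomorphism `h_r`
and pulling covectors back along it. -/
def IsPullback {l m : ℕ} (r : ℝˣ) (𝒮 𝒯 : (tensors E L l m).Sec) : Prop :=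
  ∀ (ε : slitDual L) (v : Fin l → TangentSpace (slitModel E) ε)
    (η : Fin m → (TangentSpace (slitModel E) (scale r ε) →L[ℝ] ℝ)),
    tensorEval E L l m (𝒮 ε) v (fun j => (η j).comp (dscale E L r ε)) =
      tensorEval E L l m (𝒯 (scale r ε)) (fun i => dscale E L r ε (v i)) η

/-- Homogeneous `(l, m)`-tensors on `L* ∖ 0`: those with `h_r^* 𝒯 = r ^ (1 - m) 𝒯` for all
`r ≠ 0`. -/
def IsHomogeneous {l m : ℕ} (𝒯 : (tensors E L l m).Sec) : Prop :=
  ∀ r : ℝˣ, IsPullback r ((r : ℝ) ^ (1 - (m : ℤ)) • 𝒯) 𝒯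

end
end LineBundle

end

open LineBundle

/-!
Write `λ̃` for the homogenization of a section `λ`. By the product rule `d_ε λ̃` depends only on the
`1`-jet of `λ` at `p(ε)`, and it determines this jet: its value on the Euler field is `λ̃(ε)`, and
if that vanishes, then `d_ε λ̃` is the derivative of `λ` at `p(ε)` composed with `d_ε p`, up to a
non-zero factor, where `d_ε p` is surjective. Both spaces have dimension `dim M + 1`, so
`j¹λ ↦ d_ε λ̃` is an isomorphism `p^* J¹L ≅ T^*(L^* ∖ 0)`, whose inverse is `p_{T^*}`. Since
derivations of `L` are linear maps `J¹L → L` and the pairing with `ε` trivializes `p^* L`, dualizing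
gives `p_T`, and `Φ` follows by functoriality.

The dilation `h_r` multiplies the pairing with `ε` by `r`; hence it acts as the identity through
`p_T` and as multiplication by `r` through `p_{T^*}`. The weight `1 - m` makes homogeneity of `𝒯`
the statement that `Φ ∘ 𝒯` is constant on the orbits of the dilations, which are the fibres of `p`,
and the induced section over `M` is smooth because `p` has smooth local sections.
-/

noncomputable section

namespace SmoothVB

universe u' v'

variable {E H : Type} [NormedAddCommGroup E] [NormedSpace ℝ E] [TopologicalSpace H]
  {I : ModelWithCorners ℝ E H} {B : Type u} [TopologicalSpace B] [ChartedSpace H B]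
  {E' H' : Type} [NormedAddCommGroup E'] [NormedSpace ℝ E'] [TopologicalSpace H']
  {I' : ModelWithCorners ℝ E' H'} {B' : Type u'} [TopologicalSpace B'] [ChartedSpace H' B']
  {EX HX : Type} [NormedAddCommGroup EX] [NormedSpace ℝ EX] [TopologicalSpace HX]
  {IX : ModelWithCorners ℝ EX HX} {X : Type*} [TopologicalSpace X] [ChartedSpace HX X] {x₀ : X}

/-! ### Local coordinates -/

/-- The fibre coordinate of a vector of `A` in the preferred trivialization around `i`. -/
def coord (A : SmoothVB.{u, v} I B) (i : B) {y : B} (a : A.V y) : A.F :=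
  (trivializationAt A.F A.V i ⟨y, a⟩).2

/-- The local frame of `A` around `i`: the vector over `y` whose coordinate in the preferred
trivialization around `i` is `w`. It is `0` if `y` is outside the domain `A.dom i`. -/
def frame (A : SmoothVB.{u, v} I B) (i : B) (w : A.F) (y : B) : A.V y :=
  (trivializationAt A.F A.V i).symm y w

/-- The domain of the preferred trivialization of `A` around `i`. -/
def dom (A : SmoothVB.{u, v} I B) (i : B) : Set B := (trivializationAt A.F A.V i).baseSet

lemma dom_mem_nhds (A : SmoothVB.{u, v} I B) (i : B) : A.dom i ∈ 𝓝 i :=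
  (trivializationAt A.F A.V i).open_baseSet.mem_nhds (FiberBundle.mem_baseSet_trivializationAt' i)

lemma mem_dom (A : SmoothVB.{u, v} I B) (i : B) : i ∈ A.dom i :=
  FiberBundle.mem_baseSet_trivializationAt' i

lemma coord_frame (A : SmoothVB.{u, v} I B) {i y : B} (hy : y ∈ A.dom i) (w : A.F) :
    A.coord i (A.frame i w y) = w :=
  congrArg Prod.snd ((trivializationAt A.F A.V i).apply_mk_symm hy w)

lemma frame_coord (A : SmoothVB.{u, v} I B) {i y : B} (hy : y ∈ A.dom i) (a : A.V y) :
    A.frame i (A.coord i a) y = a :=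
  (trivializationAt A.F A.V i).symm_apply_apply_mk hy a

/-- The fibre coordinate `coord` over a point of `A.dom i`, as a continuous linear equivalence. -/
def coordCLE (A : SmoothVB.{u, v} I B) {i y : B} (hy : y ∈ A.dom i) : A.V y ≃L[ℝ] A.F :=
  (trivializationAt A.F A.V i).continuousLinearEquivAt ℝ y hy

lemma coordCLE_apply (A : SmoothVB.{u, v} I B) {i y : B} (hy : y ∈ A.dom i) (a : A.V y) :
    A.coordCLE hy a = A.coord i a := rfl

lemma coordCLE_symm_apply (A : SmoothVB.{u, v} I B) {i y : B} (hy : y ∈ A.dom i) (w : A.F) :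
    (A.coordCLE hy).symm w = A.frame i w y := by
  rw [ContinuousLinearEquiv.symm_apply_eq, coordCLE_apply, coord_frame A hy]

lemma coord_add (A : SmoothVB.{u, v} I B) {i y : B} (hy : y ∈ A.dom i) (a a' : A.V y) :
    A.coord i (a + a') = A.coord i a + A.coord i a' := (A.coordCLE hy).map_add a a'

lemma coord_smul (A : SmoothVB.{u, v} I B) {i y : B} (hy : y ∈ A.dom i) (c : ℝ) (a : A.V y) :
    A.coord i (c • a) = c • A.coord i a := (A.coordCLE hy).map_smul c a

lemma coord_injective (A : SmoothVB.{u, v} I B) {i y : B} (hy : y ∈ A.dom i) :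
    Function.Injective (A.coord i : A.V y → A.F) := (A.coordCLE hy).injective

lemma frame_ne_zero (A : SmoothVB.{u, v} I B) {i y : B} (hy : y ∈ A.dom i) {w : A.F}
    (hw : w ≠ 0) : A.frame i w y ≠ 0 := by
  rw [← A.coordCLE_symm_apply hy]
  exact (A.coordCLE hy).symm.map_ne_zero_iff.2 hw

lemma frame_pullback (A : SmoothVB.{u, v} I B) {f : ContMDiffMap I' I B' B ∞} {i x : B'}
    (hx : f x ∈ A.dom (f i)) (w : A.F) :
    (A.pullback f).frame i w x = A.frame (f i) w (f x) :=
  A.coord_injective hx <|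
    ((A.pullback f).coord_frame (i := i) (y := x) hx w).trans (A.coord_frame hx w).symm

lemma finrank_fibre {F : Type} [NormedAddCommGroup F] [NormedSpace ℝ F] (V : B → Type v)
    [∀ x, AddCommGroup (V x)] [∀ x, Module ℝ (V x)] [∀ x, TopologicalSpace (V x)]
    [TopologicalSpace (TotalSpace F V)] [FiberBundle F V] [VectorBundle ℝ F V] (x : B) :
    Module.finrank ℝ (V x) = Module.finrank ℝ F :=
  ((trivializationAt F V x).continuousLinearEquivAt ℝ x
    (FiberBundle.mem_baseSet_trivializationAt' x)).toLinearEquiv.finrank_eq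

/-! ### Smooth families of vectors -/

/-- The family of vectors `a x` of the bundle `A` over the points `b x` is smooth at `x₀`. -/
def SmoothAt (A : SmoothVB.{u, v} I B) (IX : ModelWithCorners ℝ EX HX) {b : X → B}
    (a : ∀ x, A.V (b x)) (x₀ : X) : Prop :=
  ContMDiffAt IX (I.prod 𝓘(ℝ, A.F)) ∞ (fun x => (⟨b x, a x⟩ : TotalSpace A.F A.V)) x₀

section

variable {A C : SmoothVB.{u, v} I B} {b : X → B}

lemma smoothAt_iff {a : ∀ x, A.V (b x)} : A.SmoothAt IX a x₀ ↔ ContMDiffAt IX I ∞ b x₀ ∧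
    ContMDiffAt IX 𝓘(ℝ, A.F) ∞ (fun x => A.coord (b x₀) (a x)) x₀ :=
  contMDiffAt_totalSpace

lemma SmoothAt.base {a : ∀ x, A.V (b x)} (h : A.SmoothAt IX a x₀) : ContMDiffAt IX I ∞ b x₀ :=
  (smoothAt_iff.1 h).1

lemma SmoothAt.coord {a : ∀ x, A.V (b x)} (h : A.SmoothAt IX a x₀) :
    ContMDiffAt IX 𝓘(ℝ, A.F) ∞ (fun x => A.coord (b x₀) (a x)) x₀ :=
  (smoothAt_iff.1 h).2

lemma SmoothAt.congr {a a' : ∀ x, A.V (b x)} (h : A.SmoothAt IX a x₀)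
    (he : ∀ᶠ x in 𝓝 x₀, a' x = a x) : A.SmoothAt IX a' x₀ :=
  ContMDiffAt.congr_of_eventuallyEq h (he.mono fun x hx => by simp only [hx])

lemma eventually_mem_dom (A : SmoothVB.{u, v} I B) (hb : ContMDiffAt IX I ∞ b x₀) :
    ∀ᶠ x in 𝓝 x₀, b x ∈ A.dom (b x₀) :=
  hb.continuousAt.eventually (A.dom_mem_nhds (b x₀))

lemma smoothAt_frame (A : SmoothVB.{u, v} I B) (hb : ContMDiffAt IX I ∞ b x₀) (w : A.F) :
    A.SmoothAt IX (fun x => A.frame (b x₀) w (b x)) x₀ :=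
  smoothAt_iff.2 ⟨hb, contMDiffAt_const.congr_of_eventuallyEq
    ((A.eventually_mem_dom hb).mono fun _ hx => A.coord_frame hx w)⟩

lemma smoothAt_tautological (A : SmoothVB.{u, v} I B) (p₀ : TotalSpace A.F A.V) :
    A.SmoothAt (I.prod 𝓘(ℝ, A.F)) (b := TotalSpace.proj) (fun p => p.2) p₀ :=
  contMDiffAt_id

lemma smoothAt_section (s : A.Sec) (hb : ContMDiffAt IX I ∞ b x₀) :
    A.SmoothAt IX (fun x => s (b x)) x₀ :=
  (s.contMDiff.contMDiffAt (x := b x₀)).comp x₀ hb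

lemma SmoothAt.add {a a' : ∀ x, A.V (b x)} (h : A.SmoothAt IX a x₀) (h' : A.SmoothAt IX a' x₀) :
    A.SmoothAt IX (fun x => a x + a' x) x₀ :=
  smoothAt_iff.2 ⟨h.base, (h.coord.add h'.coord).congr_of_eventuallyEq
    ((A.eventually_mem_dom h.base).mono fun _ hx => A.coord_add hx _ _)⟩

lemma SmoothAt.smul {c : X → ℝ} {a : ∀ x, A.V (b x)} (hc : ContMDiffAt IX 𝓘(ℝ, ℝ) ∞ c x₀)
    (h : A.SmoothAt IX a x₀) : A.SmoothAt IX (fun x => c x • a x) x₀ :=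
  smoothAt_iff.2 ⟨h.base, (hc.smul h.coord).congr_of_eventuallyEq
    ((A.eventually_mem_dom h.base).mono fun _ hx => A.coord_smul hx _ _)⟩

lemma contMDiffAt_clm_of_apply {F G : Type} [NormedAddCommGroup F] [NormedSpace ℝ F]
    [FiniteDimensional ℝ F] [NormedAddCommGroup G] [NormedSpace ℝ G] {φ : X → F →L[ℝ] G}
    (h : ∀ w, ContMDiffAt IX 𝓘(ℝ, G) ∞ (fun x => φ x w) x₀) :
    ContMDiffAt IX 𝓘(ℝ, F →L[ℝ] G) ∞ φ x₀ := by
  let basisCoord : F ≃L[ℝ] (Fin (Module.finrank ℝ F) → ℝ) :=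
    ContinuousLinearEquiv.ofFinrankEq (by simp)
  let columns : (F →L[ℝ] G) ≃L[ℝ] (Fin (Module.finrank ℝ F) → G) :=
    (basisCoord.arrowCongr (.refl ℝ G)).trans (ContinuousLinearEquiv.piRing _)
  have hcolumns : ContMDiffAt IX 𝓘(ℝ, Fin (Module.finrank ℝ F) → G) ∞
      (fun x => columns (φ x)) x₀ := contMDiffAt_pi_space.2 fun i => h _
  exact ((columns.symm.contDiff.contMDiff.contMDiffAt (n := ∞)).comp x₀
    hcolumns).congr_of_eventuallyEq
      (.of_forall fun x => (columns.symm_apply_apply (φ x)).symm)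

lemma smoothAt_hom_of_frame [FiniteDimensional ℝ A.F] (hb : ContMDiffAt IX I ∞ b x₀)
    {φ : ∀ x, A.V (b x) →L[ℝ] C.V (b x)}
    (h : ∀ w, C.SmoothAt IX (fun x => φ x (A.frame (b x₀) w (b x))) x₀) :
    (hom A C).SmoothAt IX φ x₀ := by
  refine (contMDiffAt_hom_bundle (F₁ := A.F) (F₂ := C.F) (E₁ := A.V) (E₂ := C.V)
    (fun x => ⟨b x, φ x⟩)).2 ⟨hb, contMDiffAt_clm_of_apply fun w => ?_⟩
  refine (h w).coord.congr_of_eventuallyEq ?_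
  filter_upwards [A.eventually_mem_dom hb, C.eventually_mem_dom hb] with x hA hC
  rw [ContinuousLinearMap.inCoordinates_eq hA hC, ← A.coordCLE_symm_apply hA w]
  rfl

lemma SmoothAt.apply {φ : ∀ x, A.V (b x) →L[ℝ] C.V (b x)} {a : ∀ x, A.V (b x)}
    (h : (hom A C).SmoothAt IX φ x₀) (ha : A.SmoothAt IX a x₀) :
    C.SmoothAt IX (fun x => φ x (a x)) x₀ :=
  ContMDiffAt.clm_bundle_apply (F₁ := A.F) (F₂ := C.F) (E₁ := A.V) (E₂ := C.V)
    (IB := I) (b := b) (ϕ := φ) (v := a) h ha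

lemma smoothAt_trivialLine_iff {c : X → ℝ} :
    (trivialLine I B).SmoothAt IX (b := b) c x₀ ↔
      ContMDiffAt IX I ∞ b x₀ ∧ ContMDiffAt IX 𝓘(ℝ, ℝ) ∞ c x₀ :=
  smoothAt_iff

lemma smoothAt_transport_iff {V' : B → Type w} [∀ x, AddCommGroup (V' x)]
    [∀ x, Module ℝ (V' x)] {Φ : ∀ x, V' x ≃ₗ[ℝ] A.V x} {a : ∀ x, V' (b x)} :
    (A.transport V' Φ).SmoothAt IX (b := b) a x₀ ↔ A.SmoothAt IX (fun x => Φ (b x) (a x)) x₀ :=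
  (smoothAt_iff (A := A.transport V' Φ) (a := a)).trans (smoothAt_iff (A := A)).symm

end

lemma smoothAt_pullback_iff {A : SmoothVB.{u, v} I B} {f : ContMDiffMap I' I B' B ∞} {b : X → B'}
    {a : ∀ x, A.V (f (b x))} :
    (A.pullback f).SmoothAt IX (b := b) a x₀ ↔
      ContMDiffAt IX I' ∞ b x₀ ∧ A.SmoothAt IX (b := fun x => f (b x)) a x₀ :=
  ⟨fun h => ⟨h.base, smoothAt_iff.2 ⟨f.contMDiff.contMDiffAt.comp x₀ h.base, h.coord⟩⟩,
    fun h => smoothAt_iff.2 ⟨h.1, h.2.coord⟩⟩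

/-! ### Isomorphisms -/

section

variable {A : SmoothVB.{u, v} I B} {C : SmoothVB.{u, w} I B}

lemma Iso.smoothAt (φ : Iso A C) {b : X → B} {a : ∀ x, A.V (b x)} (h : A.SmoothAt IX a x₀) :
    C.SmoothAt IX (fun x => φ.toFun (b x) (a x)) x₀ :=
  ContMDiffAt.comp (g := fun p : TotalSpace A.F A.V => (⟨p.1, φ.toFun p.1 p.2⟩ :
    TotalSpace C.F C.V)) x₀ φ.smooth_toFun.contMDiffAt h

/-- The inverse isomorphism. -/
def Iso.symm (φ : Iso A C) : Iso C A where
  toFun x := (φ.toFun x).symm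
  smooth_toFun := φ.smooth_invFun
  smooth_invFun := φ.smooth_toFun

/-- The composition of isomorphisms. -/
def Iso.trans {D : SmoothVB.{u, v'} I B} (φ : Iso A C) (ψ : Iso C D) : Iso A D where
  toFun x := (φ.toFun x).trans (ψ.toFun x)
  smooth_toFun := ψ.smooth_toFun.comp φ.smooth_toFun
  smooth_invFun := φ.smooth_invFun.comp ψ.smooth_invFun

lemma Iso.smoothAt_pullback (φ : Iso A C) {f : ContMDiffMap I' I B' B ∞} {b : X → B'}
    {a : ∀ x, A.V (f (b x))} (h : (A.pullback f).SmoothAt IX (b := b) a x₀) :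
    (C.pullback f).SmoothAt IX (b := b) (fun x => φ.toFun (f (b x)) (a x)) x₀ :=
  smoothAt_pullback_iff.2 ⟨h.base, φ.smoothAt (smoothAt_pullback_iff.1 h).2⟩

/-- The pull-back of an isomorphism along a smooth map. -/
def Iso.pullback (φ : Iso A C) (f : ContMDiffMap I' I B' B ∞) :
    Iso (A.pullback f) (C.pullback f) where
  toFun x := φ.toFun (f x)
  smooth_toFun p₀ := φ.smoothAt_pullback ((A.pullback f).smoothAt_tautological p₀)
  smooth_invFun p₀ := φ.symm.smoothAt_pullback ((C.pullback f).smoothAt_tautological p₀)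

/-- The structural isomorphism from a transported bundle to the bundle it is modelled on. -/
def transportIso (A : SmoothVB.{u, v} I B) (V' : B → Type w)
    [∀ x, AddCommGroup (V' x)] [∀ x, Module ℝ (V' x)] (Φ : ∀ x, V' x ≃ₗ[ℝ] A.V x) :
    Iso (A.transport V' Φ) A where
  toFun x :=
    { toLinearEquiv := Φ x
      continuous_toFun := continuous_induced_dom
      continuous_invFun := continuous_induced_rng.2 <|
        continuous_id.congr fun a => ((Φ x).apply_symm_apply a).symm }
  smooth_toFun p₀ := (smoothAt_transport_iff (b := TotalSpace.proj)
    (X := TotalSpace (A.transport V' Φ).F (A.transport V' Φ).V) (a := fun p => p.2)).1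
      ((A.transport V' Φ).smoothAt_tautological p₀)
  smooth_invFun p₀ := (smoothAt_transport_iff (b := TotalSpace.proj)
    (a := fun p : TotalSpace A.F A.V => (Φ p.1).symm p.2)).2 <|
      (A.smoothAt_tautological p₀).congr (.of_forall fun p => (Φ p.1).apply_symm_apply p.2)

/-- The fibrewise linear map `φ` takes the local frames of `A` to smooth families of vectors
of `C`. -/
def SmoothOnFrames (φ : ∀ x, A.V x →ₗ[ℝ] C.V x) : Prop :=
  ∀ i w, C.SmoothAt I (b := fun x => x) (fun x => φ x (A.frame i w x)) i

variable [FiniteDimensional ℝ A.F]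

/-- The matrix at `x` of a fibrewise linear map, in the preferred trivializations around `i`.
It is `0` if `x` is outside one of their domains. -/
def inCoord (φ : ∀ x, A.V x →ₗ[ℝ] C.V x) (i x : B) : A.F →L[ℝ] C.F :=
  LinearMap.toContinuousLinearMap
    ((trivializationAt C.F C.V i).linearMapAt ℝ x ∘ₗ φ x ∘ₗ
      (trivializationAt A.F A.V i).symmₗ ℝ x)

lemma inCoord_apply (φ : ∀ x, A.V x →ₗ[ℝ] C.V x) {i x : B} (hA : x ∈ A.dom i)
    (hC : x ∈ C.dom i) (w : A.F) : inCoord φ i x w = C.coord i (φ x (A.frame i w x)) := by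
  have hframe : (trivializationAt A.F A.V i).symmₗ ℝ x w = A.frame i w x := by
    rw [Trivialization.coe_symmₗ (hb := hA)]
    rfl
  change (trivializationAt C.F C.V i).linearMapAt ℝ x (φ x _) = _
  rw [hframe, Trivialization.coe_linearMapAt_of_mem _ hC]
  rfl

lemma SmoothOnFrames.contMDiffAt_inCoord {φ : ∀ x, A.V x →ₗ[ℝ] C.V x} (h : SmoothOnFrames φ)
    (i : B) : ContMDiffAt I 𝓘(ℝ, A.F →L[ℝ] C.F) ∞ (inCoord φ i) i := by
  refine contMDiffAt_clm_of_apply fun w => (h i w).coord.congr_of_eventuallyEq ?_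
  filter_upwards [A.dom_mem_nhds i, C.dom_mem_nhds i] with x hA hC using inCoord_apply φ hA hC w

lemma SmoothOnFrames.smoothAt {φ : ∀ x, A.V x →ₗ[ℝ] C.V x} (h : SmoothOnFrames φ) {b : X → B}
    {a : ∀ x, A.V (b x)} (ha : A.SmoothAt IX a x₀) :
    C.SmoothAt IX (fun x => φ (b x) (a x)) x₀ := by
  refine smoothAt_iff.2 ⟨ha.base, ContMDiffAt.congr_of_eventuallyEq
    (((h.contMDiffAt_inCoord (b x₀)).comp x₀ ha.base).clm_apply ha.coord) ?_⟩
  filter_upwards [A.eventually_mem_dom ha.base, C.eventually_mem_dom ha.base] with x hA hC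
  rw [Function.comp_apply, inCoord_apply φ hA hC, frame_coord A hA]

/-- The matrix at `x` of a fibrewise linear isomorphism, in the preferred trivializations
around `i`, as an equivalence of the model fibres. -/
def inCoordEquiv (φ : ∀ x, A.V x ≃ₗ[ℝ] C.V x) {i x : B} (hA : x ∈ A.dom i) (hC : x ∈ C.dom i) :
    A.F ≃L[ℝ] C.F :=
  ((A.coordCLE hA).symm.toLinearEquiv ≪≫ₗ φ x ≪≫ₗ
    (C.coordCLE hC).toLinearEquiv).toContinuousLinearEquiv

lemma coe_inCoordEquiv (φ : ∀ x, A.V x ≃ₗ[ℝ] C.V x) {i x : B} (hA : x ∈ A.dom i)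
    (hC : x ∈ C.dom i) :
    (inCoordEquiv φ hA hC : A.F →L[ℝ] C.F) = inCoord (fun x => (φ x).toLinearMap) i x := by
  ext w
  rw [inCoord_apply _ hA hC, ← A.coordCLE_symm_apply hA]
  rfl

lemma inCoordEquiv_symm_apply (φ : ∀ x, A.V x ≃ₗ[ℝ] C.V x) {i x : B} (hA : x ∈ A.dom i)
    (hC : x ∈ C.dom i) (w : C.F) :
    (inCoordEquiv φ hA hC).symm w = A.coord i ((φ x).symm (C.frame i w x)) := by
  rw [← C.coordCLE_symm_apply hC]
  rfl

/-- Inversion of continuous linear maps is smooth at invertible ones. -/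
lemma SmoothOnFrames.symm {φ : ∀ x, A.V x ≃ₗ[ℝ] C.V x}
    (h : SmoothOnFrames fun x => (φ x).toLinearMap) :
    SmoothOnFrames fun x => (φ x).symm.toLinearMap := by
  intro i w
  have : CompleteSpace A.F := FiniteDimensional.complete ℝ A.F
  have hinverse : ContMDiffAt I 𝓘(ℝ, C.F →L[ℝ] A.F) ∞
      (fun x => (inCoord (fun x => (φ x).toLinearMap) i x).inverse) i := by
    refine ContDiffAt.comp_contMDiffAt (g := ContinuousLinearMap.inverse) ?_
      (h.contMDiffAt_inCoord i)
    rw [← coe_inCoordEquiv φ (A.mem_dom i) (C.mem_dom i)]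
    exact contDiffAt_map_inverse _
  refine smoothAt_iff.2 ⟨contMDiffAt_id,
    (hinverse.clm_apply (contMDiffAt_const (c := w))).congr_of_eventuallyEq ?_⟩
  filter_upwards [A.dom_mem_nhds i, C.dom_mem_nhds i] with x hA hC
  rw [← coe_inCoordEquiv φ hA hC, ContinuousLinearMap.inverse_equiv]
  exact (inCoordEquiv_symm_apply φ hA hC w).symm

/-- A fibrewise linear isomorphism of bundles of finite rank that is smooth on frames, as an
isomorphism of smooth vector bundles. -/
def Iso.ofLinearEquiv [FiniteDimensional ℝ C.F] (φ : ∀ x, A.V x ≃ₗ[ℝ] C.V x)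
    (h : SmoothOnFrames fun x => (φ x).toLinearMap) : Iso A C where
  toFun x :=
    { toLinearEquiv := φ x
      continuous_toFun := continuous_of_fibre A (φ x).toLinearMap
      continuous_invFun := continuous_of_fibre C (φ x).symm.toLinearMap }
  smooth_toFun p₀ := h.smoothAt (A.smoothAt_tautological p₀)
  smooth_invFun p₀ := h.symm.smoothAt (C.smoothAt_tautological p₀)

end

/-! ### Bundles of multilinear maps -/

instance : FiniteDimensional ℝ (trivialLine I B).F := inferInstanceAs (FiniteDimensional ℝ ℝ)

instance {f : ContMDiffMap I' I B' B ∞} {A : SmoothVB.{u, v} I B} [FiniteDimensional ℝ A.F] :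
    FiniteDimensional ℝ (A.pullback f).F := inferInstanceAs (FiniteDimensional ℝ A.F)

instance {A C : SmoothVB.{u, v} I B} [FiniteDimensional ℝ A.F] [FiniteDimensional ℝ C.F] :
    FiniteDimensional ℝ (A.hom C).F := inferInstanceAs (FiniteDimensional ℝ (A.F →L[ℝ] C.F))

section

variable {A C : SmoothVB.{u, v} I B} {A' C' : SmoothVB.{u', v'} I' B'}
  {f : ContMDiffMap I' I B' B ∞}

section

variable [FiniteDimensional ℝ A.F] [FiniteDimensional ℝ A'.F]

/-- The isomorphism of `Hom` bundles induced by isomorphisms onto pull-backs. -/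
def Iso.homPullback (α : Iso A' (A.pullback f)) (γ : Iso C' (C.pullback f)) :
    Iso (hom A' C') ((hom A C).pullback f) where
  toFun x := (α.toFun x).arrowCongr (γ.toFun x)
  smooth_toFun p₀ := by
    have hT := (hom A' C').smoothAt_tautological p₀
    have hproj := f.contMDiff.contMDiffAt.comp p₀ hT.base
    refine smoothAt_pullback_iff.2 ⟨hT.base, smoothAt_hom_of_frame hproj fun w => ?_⟩
    have hframe := smoothAt_pullback_iff.2 ⟨hT.base, smoothAt_frame A hproj w⟩
    exact (smoothAt_pullback_iff.1 (γ.smoothAt (hT.apply (α.symm.smoothAt hframe)))).2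
  smooth_invFun p₀ := by
    obtain ⟨hproj, hT⟩ :=
      smoothAt_pullback_iff.1 (((hom A C).pullback f).smoothAt_tautological p₀)
    refine smoothAt_hom_of_frame hproj fun w => ?_
    have hframe := (smoothAt_pullback_iff.1 (α.smoothAt (smoothAt_frame A' hproj w))).2
    exact γ.symm.smoothAt (smoothAt_pullback_iff.2 ⟨hproj, hT.apply hframe⟩)

lemma Iso.homPullback_apply (α : Iso A' (A.pullback f)) (γ : Iso C' (C.pullback f)) {x : B'}
    (T : A'.V x →L[ℝ] C'.V x) (a : A'.V x) :
    (show A.V (f x) →L[ℝ] C.V (f x) from (α.homPullback γ).toFun x T) (α.toFun x a) =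
      γ.toFun x (T a) :=
  congrArg (fun a => γ.toFun x (T a)) ((α.toFun x).symm_apply_apply a)

/-- The isomorphism of bundles of multilinear maps induced by isomorphisms onto pull-backs. -/
def Iso.multiPullback (α : Iso A' (A.pullback f)) (γ : Iso C' (C.pullback f)) :
    (k : ℕ) → Iso (multi A' C' k) ((multi A C k).pullback f)
  | 0 => γ
  | k + 1 => α.homPullback (Iso.multiPullback α γ k)

lemma Iso.eval_multiPullback (α : Iso A' (A.pullback f)) (γ : Iso C' (C.pullback f)) {x : B'}
    (k : ℕ) (T : (multi A' C' k).V x) (a : Fin k → A'.V x) :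
    eval A C (x := f x) k ((α.multiPullback γ k).toFun x T) (fun i => α.toFun x (a i)) =
      γ.toFun x (eval A' C' k T a) := by
  induction k with
  | zero => rfl
  | succ k ih =>
    refine Eq.trans ?_ (ih _ _)
    exact congrArg (fun S => eval A C (x := f x) k S (fun i => α.toFun x (a i.succ)))
      (α.homPullback_apply (α.multiPullback γ k) T (a 0))

end

lemma eval_injective {x : B} (k : ℕ) {T T' : (multi A C k).V x}
    (h : ∀ a, eval A C k T a = eval A C k T' a) : T = T' := by
  induction k with
  | zero => exact h Fin.elim0
  | succ k ih =>
    exact ContinuousLinearMap.ext (R₁ := ℝ) (R₂ := ℝ) (M₁ := A.V x) (M₂ := (multi A C k).V x)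
      fun a₀ => ih fun a => h (Fin.cons a₀ a)

lemma eval_smul {x : B} (k : ℕ) (c : ℝ) (T : (multi A C k).V x) (a : Fin k → A.V x) :
    eval A C k (c • T) a = c • eval A C k T a := by
  induction k with
  | zero => rfl
  | succ k ih => exact ih _ _

lemma eval_smul_args {x : B} (k : ℕ) (c : ℝ) (T : (multi A C k).V x) (a : Fin k → A.V x) :
    eval A C k T (fun i => c • a i) = c ^ k • eval A C k T a := by
  induction k with
  | zero => exact (one_smul ℝ _).symm
  | succ k ih =>
    have hT : (show A.V x →L[ℝ] (multi A C k).V x from T) (c • a 0) =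
        c • (show A.V x →L[ℝ] (multi A C k).V x from T) (a 0) := ContinuousLinearMap.map_smul _ _ _
    refine (congrArg (fun S => eval A C k S fun i => c • a i.succ) hT).trans ?_
    rw [ih, eval_smul, smul_smul, ← pow_succ]
    rfl

end

/-! ### Biduality -/

instance (A : SmoothVB.{u, v} I B) [FiniteDimensional ℝ A.F] (x : B) :
    FiniteDimensional ℝ (A.V x) :=
  (A.coordCLE (A.mem_dom x)).symm.toLinearEquiv.finiteDimensional

lemma t2Space_fibre (A : SmoothVB.{u, v} I B) (x : B) : T2Space (A.V x) :=
  (A.coordCLE (A.mem_dom x)).symm.toHomeomorph.t2Space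

/-- A finite-dimensional Hausdorff topological vector space is isomorphic to its bidual. -/
def bidualEquiv (V : Type*) [AddCommGroup V] [Module ℝ V] [TopologicalSpace V]
    [IsTopologicalAddGroup V] [ContinuousSMul ℝ V] [T2Space V] [FiniteDimensional ℝ V] :
    V ≃ₗ[ℝ] ((V →L[ℝ] ℝ) →L[ℝ] ℝ) :=
  haveI : FiniteDimensional ℝ (V →L[ℝ] ℝ) :=
    (LinearMap.toContinuousLinearMap (𝕜 := ℝ) (E := V) (F' := ℝ)).finiteDimensional
  Module.evalEquiv ℝ V ≪≫ₗ
    (LinearMap.toContinuousLinearMap (𝕜 := ℝ) (E := V) (F' := ℝ)).symm.dualMap ≪≫ₗ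
    LinearMap.toContinuousLinearMap

/-- The isomorphism of a vector bundle of finite rank with its bidual. -/
def bidualIso (A : SmoothVB.{u, 0} I B) [FiniteDimensional ℝ A.F] :
    Iso A ((A.hom (trivialLine I B)).hom (trivialLine I B)) :=
  Iso.ofLinearEquiv (C := (A.hom (trivialLine I B)).hom (trivialLine I B))
    (fun x => haveI := A.t2Space_fibre x; bidualEquiv (A.V x)) fun _ w =>
      smoothAt_hom_of_frame (A := A.hom (trivialLine I B)) contMDiffAt_id fun w' =>
        (smoothAt_frame (A.hom (trivialLine I B)) (b := fun x => x) contMDiffAt_id w').apply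
          (smoothAt_frame A (b := fun x => x) contMDiffAt_id w)

lemma finrank_continuousDual (V : Type*) [NormedAddCommGroup V] [NormedSpace ℝ V]
    [FiniteDimensional ℝ V] : Module.finrank ℝ (V →L[ℝ] ℝ) = Module.finrank ℝ V :=
  (LinearMap.toContinuousLinearMap (𝕜 := ℝ) (E := V) (F' := ℝ)).finrank_eq.symm.trans
    Subspace.dual_finrank_eq

end SmoothVB

namespace LineBundle

variable {E : Type} [NormedAddCommGroup E] [NormedSpace ℝ E]
  {M : Type u} [TopologicalSpace M]
  {L : M → Type u} [TopologicalSpace (TotalSpace ℝ L)] [∀ x, AddCommGroup (L x)]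
  [∀ x, Module ℝ (L x)] [∀ x, TopologicalSpace (L x)] [FiberBundle ℝ L] [VectorBundle ℝ ℝ L]

/-! ### One-dimensional fibres -/

variable (L) in
lemma finrank_fibre (x : M) : Module.finrank ℝ (L x) = 1 :=
  (SmoothVB.finrank_fibre (F := ℝ) L x).trans (Module.finrank_self ℝ)

variable (L) in
lemma finrank_dual (x : M) : Module.finrank ℝ (Dual L x) = 1 := by
  rw [SmoothVB.finrank_fibre (F := ℝ →L[ℝ] ℝ) (Dual L) x, SmoothVB.finrank_continuousDual,
    Module.finrank_self]

variable (L) in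
lemma exists_dual_ne_zero (x : M) : ∃ ξ : Dual L x, ξ ≠ 0 :=
  have := Module.nontrivial_of_finrank_pos (R := ℝ) (finrank_dual L x ▸ one_pos)
  exists_ne 0

lemma exists_scale_eq {ε η : slitDual L} (h : η.1.1 = ε.1.1) : ∃ r : ℝˣ, scale r ε = η := by
  obtain ⟨⟨x, ξ⟩, hξ⟩ := ε
  obtain ⟨⟨y, ζ⟩, hζ⟩ := η
  obtain rfl : y = x := h
  obtain ⟨c, rfl⟩ := exists_smul_eq_of_finrank_eq_one (finrank_dual L y) hξ ζ
  exact ⟨Units.mk0 c (left_ne_zero_of_smul hζ), rfl⟩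

lemma pairing_bijective (ε : slitDual L) :
    Function.Bijective ((ε.1.2 : L ε.1.1 →L[ℝ] ℝ) : L ε.1.1 →ₗ[ℝ] ℝ) := by
  have hdim := finrank_fibre L ε.1.1
  have := Module.finite_of_finrank_eq_succ hdim
  have hsurj : Function.Surjective ((ε.1.2 : L ε.1.1 →L[ℝ] ℝ) : L ε.1.1 →ₗ[ℝ] ℝ) :=
    LinearMap.surjective fun h => ε.2 (ContinuousLinearMap.coe_injective h)
  exact ⟨(LinearMap.injective_iff_surjective_of_finrank_eq_finrank
    (hdim.trans (Module.finrank_self ℝ).symm)).2 hsurj, hsurj⟩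

/-- The pairing with `ε`, as a linear isomorphism from the fibre of `L`. -/
def pairingEquiv (ε : slitDual L) : L ε.1.1 ≃ₗ[ℝ] ℝ :=
  LinearEquiv.ofBijective _ (pairing_bijective ε)

/-- The coordinate of a covector with respect to the preferred local frame of `L` around `i`. -/
def fibreCoord (i : M) (ε : slitDual L) : ℝ := ε.1.2 ((trivializationAt ℝ L i).symm ε.1.1 1)

lemma apply_eq_fibreCoord_mul {i : M} {ε : slitDual L}
    (hε : ε.1.1 ∈ (trivializationAt ℝ L i).baseSet) (a : L ε.1.1) :
    ε.1.2 a = fibreCoord i ε * (trivializationAt ℝ L i ⟨ε.1.1, a⟩).2 := by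
  set e := trivializationAt ℝ L i
  have ha : a = (e ⟨ε.1.1, a⟩).2 • e.symm ε.1.1 1 := calc
    a = e.symm ε.1.1 ((e ⟨ε.1.1, a⟩).2 • 1) := by
      rw [smul_eq_mul, mul_one, e.symm_apply_apply_mk hε a]
    _ = (e ⟨ε.1.1, a⟩).2 • e.symm ε.1.1 1 := by
      simp only [← e.coe_symmₗ (R := ℝ) (hb := hε), map_smul]
  exact (congrArg ε.1.2 ha).trans ((ε.1.2.map_smul _ _).trans (mul_comm _ _))

lemma fibreCoord_ne_zero {i : M} {ε : slitDual L}
    (hε : ε.1.1 ∈ (trivializationAt ℝ L i).baseSet) : fibreCoord i ε ≠ 0 := fun h =>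
  ε.2 <| ContinuousLinearMap.ext fun a => by
    rw [apply_eq_fibreCoord_mul hε, h, zero_mul]
    rfl

/-! ### The complement of the zero section of the dual line bundle -/

variable [ChartedSpace E M]

lemma homogenize_add (s t : Sec E L) : homogenize (s + t) = homogenize s + homogenize t :=
  funext fun ε => ε.1.2.map_add _ _

lemma homogenize_smul (c : ℝ) (s : Sec E L) : homogenize (c • s) = c • homogenize s :=
  funext fun ε => ε.1.2.map_smul _ _

lemma loc_eq_zero_iff {x : M} {s : Sec E L} : loc x s x = 0 ↔ s x = 0 :=
  ((trivializationAt ℝ L x).continuousLinearEquivAt ℝ x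
    (mem_baseSet_trivializationAt ℝ L x)).map_eq_zero_iff (x := s x)

variable [ContMDiffVectorBundle ∞ ℝ L 𝓘(ℝ, E)]
  {EX HX : Type} [NormedAddCommGroup EX] [NormedSpace ℝ EX] [TopologicalSpace HX]
  {IX : ModelWithCorners ℝ EX HX} {X : Type*} [TopologicalSpace X] [ChartedSpace HX X] {x₀ : X}

variable (E L) in
/-- The dual line bundle `L*`. -/
def dualVB : SmoothVB.{u, u} 𝓘(ℝ, E) M where
  F := ℝ →L[ℝ] ℝ
  V := Dual L

instance : FiniteDimensional ℝ (lineVB E L).F := inferInstanceAs (FiniteDimensional ℝ ℝ)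

lemma contMDiffAt_slitDual_iff {e : X → slitDual L} :
    ContMDiffAt IX (slitModel E) ∞ e x₀ ↔
      (dualVB E L).SmoothAt IX (b := fun x => (e x).1.1) (fun x => (e x).1.2) x₀ :=
  (ContMDiffAt.subtypeVal_comp_iff (slitDual L) e x₀).symm

lemma contMDiffAt_pairing {b : X → M} {ξ : ∀ x, Dual L (b x)} {a : ∀ x, L (b x)}
    (hξ : (dualVB E L).SmoothAt IX ξ x₀) (ha : (lineVB E L).SmoothAt IX a x₀) :
    ContMDiffAt IX 𝓘(ℝ, ℝ) ∞ (fun x => (ξ x (a x) : ℝ)) x₀ := by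
  have happly : ContMDiffAt IX (𝓘(ℝ, E).prod 𝓘(ℝ, ℝ)) ∞
      (fun x => (⟨b x, ξ x (a x)⟩ : TotalSpace ℝ (Bundle.Trivial M ℝ))) x₀ :=
    ContMDiffAt.clm_bundle_apply (F₁ := ℝ) (F₂ := ℝ) (E₁ := L) (E₂ := Bundle.Trivial M ℝ)
      (b := b) (ϕ := ξ) (v := a) hξ ha
  exact (SmoothVB.smoothAt_trivialLine_iff.1 happly).2

lemma contMDiff_homogenize (s : Sec E L) :
    ContMDiff (slitModel E) 𝓘(ℝ, ℝ) ∞ (homogenize s) := fun _ =>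
  contMDiffAt_pairing (contMDiffAt_slitDual_iff.1 contMDiffAt_id)
    (SmoothVB.smoothAt_section (A := lineVB E L) s (proj E L).contMDiff.contMDiffAt)

lemma mdifferentiableAt_homogenize (s : Sec E L) (ε : slitDual L) :
    MDifferentiableAt (slitModel E) 𝓘(ℝ, ℝ) (homogenize s) ε :=
  (contMDiff_homogenize s).mdifferentiable (by simp) ε

lemma contMDiffAt_fibreCoord (ε : slitDual L) :
    ContMDiffAt (slitModel E) 𝓘(ℝ, ℝ) ∞ (fibreCoord (L := L) ε.1.1) ε :=
  contMDiffAt_pairing (contMDiffAt_slitDual_iff.1 contMDiffAt_id)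
    (SmoothVB.smoothAt_frame (lineVB E L) (b := fun η : slitDual L => η.1.1)
      (proj E L).contMDiff.contMDiffAt (1 : ℝ))

lemma contMDiffAt_scale {c : X → ℝˣ} {e : X → slitDual L}
    (hc : ContMDiffAt IX 𝓘(ℝ, ℝ) ∞ (fun x => (c x : ℝ)) x₀)
    (he : ContMDiffAt IX (slitModel E) ∞ e x₀) :
    ContMDiffAt IX (slitModel E) ∞ (fun x => scale (c x) (e x)) x₀ :=
  contMDiffAt_slitDual_iff.2
    (SmoothVB.SmoothAt.smul (A := dualVB E L) hc (contMDiffAt_slitDual_iff.1 he))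

variable (E) in
lemma contMDiff_scale (r : ℝˣ) :
    ContMDiff (slitModel E) (slitModel E) ∞ (scale r : slitDual L → slitDual L) := fun _ =>
  contMDiffAt_scale contMDiffAt_const contMDiffAt_id

variable (E L) in
/-- The trivialization of the pull-back of `L` to `L* ∖ 0` by the tautological pairing. -/
def lineIso : ((lineVB E L).pullback (proj E L)).Iso
    (SmoothVB.trivialLine (slitModel E) (slitDual L)) :=
  SmoothVB.Iso.ofLinearEquiv (A := (lineVB E L).pullback (proj E L))
    (C := SmoothVB.trivialLine (slitModel E) (slitDual L)) pairingEquiv fun _ w =>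
      SmoothVB.smoothAt_trivialLine_iff.2 ⟨contMDiffAt_id, contMDiffAt_pairing
        (contMDiffAt_slitDual_iff.1 contMDiffAt_id) (SmoothVB.smoothAt_pullback_iff.1
          (SmoothVB.smoothAt_frame ((lineVB E L).pullback (proj E L)) contMDiffAt_id w)).2⟩

lemma pairing_lineIso_symm (ε : slitDual L) (c : ℝ) :
    ε.1.2 (((lineIso E L).toFun ε).symm c) = c :=
  ((lineIso E L).toFun ε).apply_symm_apply c

variable (E) in
lemma exists_localSection (ε : slitDual L) : ∃ σ : M → slitDual L, σ (proj E L ε) = ε ∧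
    ContMDiffAt 𝓘(ℝ, E) (slitModel E) ∞ σ (proj E L ε) ∧
    ∀ᶠ y in 𝓝 (proj E L ε), proj E L (σ y) = y := by
  classical
  let D := dualVB E L
  let w : D.F := D.coord ε.1.1 (y := ε.1.1) ε.1.2
  let ζ : ∀ y, Dual L y := D.frame ε.1.1 w
  have hζ : ζ ε.1.1 = ε.1.2 := D.frame_coord (D.mem_dom ε.1.1) _
  have hw : w ≠ 0 := fun h =>
    ε.2 ((D.coordCLE (D.mem_dom ε.1.1)).map_eq_zero_iff.1 h)
  let σ : M → slitDual L := fun y => if h : ζ y ≠ 0 then ⟨⟨y, ζ y⟩, h⟩ else ε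
  have hσ : ∀ᶠ y in 𝓝 ε.1.1, (σ y).1 = ⟨y, ζ y⟩ := by
    filter_upwards [D.dom_mem_nhds ε.1.1] with y hy
    exact congrArg Subtype.val (dif_pos (D.frame_ne_zero hy hw : ζ y ≠ 0))
  refine ⟨σ, ?_, ?_, hσ.mono fun y hy => congrArg TotalSpace.proj hy⟩
  · refine Subtype.ext (hσ.self_of_nhds.trans ?_)
    exact congrArg (TotalSpace.mk' (ℝ →L[ℝ] ℝ) ε.1.1) hζ
  · exact (ContMDiffAt.subtypeVal_comp_iff (slitDual L) σ _).1
      ((SmoothVB.smoothAt_frame D (b := fun y => y) contMDiffAt_id w).congr_of_eventuallyEq hσ)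

lemma mfderiv_proj_surjective (ε : slitDual L) :
    Function.Surjective (mfderiv (slitModel E) 𝓘(ℝ, E) (proj E L) ε) := by
  obtain ⟨σ, hσε, hσ, hproj⟩ := exists_localSection E ε
  have hp : HasMFDerivAt (slitModel E) 𝓘(ℝ, E) (proj E L) (σ (proj E L ε))
      (mfderiv (slitModel E) 𝓘(ℝ, E) (proj E L) ε) := by
    rw [hσε]
    exact ((proj E L).contMDiff.mdifferentiable (by simp) ε).hasMFDerivAt
  have hcomp := hp.comp (proj E L ε) (hσ.mdifferentiableAt (by simp)).hasMFDerivAt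
  have hid := hasMFDerivAt_unique hcomp
    ((hasMFDerivAt_id (proj E L ε)).congr_of_eventuallyEq hproj)
  exact fun v => ⟨_, DFunLike.congr_fun hid v⟩

/-! ### Differentials of homogenizations -/

-- Locally `s̃ = fibreCoord · (loc s ∘ p)`.
lemma mfderiv_homogenize (s : Sec E L) (ε : slitDual L) (v : TangentSpace (slitModel E) ε) :
    mfderiv (slitModel E) 𝓘(ℝ, ℝ) (homogenize s) ε v =
      (fibreCoord ε.1.1 ε * (show ℝ from mfderiv 𝓘(ℝ, E) 𝓘(ℝ, ℝ) (loc ε.1.1 s) ε.1.1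
        (mfderiv (slitModel E) 𝓘(ℝ, E) (proj E L) ε v)) +
      loc ε.1.1 s ε.1.1 * (show ℝ from
        mfderiv (slitModel E) 𝓘(ℝ, ℝ) (fibreCoord (L := L) ε.1.1) ε v) : ℝ) := by
  have hp := (proj E L).contMDiff.mdifferentiable (by simp) ε
  have hloc : HasMFDerivAt 𝓘(ℝ, E) 𝓘(ℝ, ℝ) (loc ε.1.1 s) (proj E L ε) _ :=
    (mdifferentiableAt_loc (mem_base (E := E) (L := L) ε.1.1) s).hasMFDerivAt
  have hcoord := (contMDiffAt_fibreCoord (E := E) ε).mdifferentiableAt (by simp)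
  have hprod : homogenize s =ᶠ[𝓝 ε] fibreCoord ε.1.1 * (loc ε.1.1 s ∘ proj E L) := by
    have hdom : ∀ᶠ y in 𝓝 (proj E L ε), y ∈ (trivializationAt ℝ L ε.1.1).baseSet :=
      (lineVB E L).dom_mem_nhds ε.1.1
    filter_upwards [(proj E L).contMDiff.continuous.continuousAt.eventually hdom] with η hη
    exact apply_eq_fibreCoord_mul hη (s η.1.1)
  rw [hprod.mfderiv_eq,
    (hcoord.hasMFDerivAt.mul (HasMFDerivAt.comp ε hloc hp.hasMFDerivAt)).mfderiv]
  rfl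

/-- The differential at `ε` of the homogenization, as a linear function of the section. -/
def homogenizeDiff (ε : slitDual L) : Sec E L →ₗ[ℝ] (TangentSpace (slitModel E) ε →L[ℝ] ℝ) where
  toFun s := mfderiv (slitModel E) 𝓘(ℝ, ℝ) (homogenize s) ε
  map_add' s t := by
    rw [homogenize_add]
    exact mfderiv_add (mdifferentiableAt_homogenize s ε) (mdifferentiableAt_homogenize t ε)
  map_smul' c s := by
    rw [homogenize_smul]
    exact const_smul_mfderiv (mdifferentiableAt_homogenize s ε) c

/-- The orbit of `ε` under the dilations with positive factor. -/
def dilationCurve (ε : slitDual L) (t : ℝ) : slitDual L :=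
  scale (Units.mk0 (Real.exp t) (Real.exp_ne_zero t)) ε

lemma dilationCurve_zero (ε : slitDual L) : dilationCurve ε 0 = ε :=
  Subtype.ext <| congrArg (TotalSpace.mk' (ℝ →L[ℝ] ℝ) ε.1.1) <| by
    change Real.exp 0 • ε.1.2 = ε.1.2
    rw [Real.exp_zero, one_smul]

lemma contMDiff_dilationCurve (ε : slitDual L) :
    ContMDiff 𝓘(ℝ, ℝ) (slitModel E) ∞ (dilationCurve ε) := fun _ =>
  contMDiffAt_scale Real.contDiff_exp.contMDiff.contMDiffAt contMDiffAt_const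

variable (E) in
/-- The Euler vector field of `L* ∖ 0`, the generator of the dilations. -/
def eulerField (ε : slitDual L) : TangentSpace (slitModel E) ε :=
  mfderiv 𝓘(ℝ, ℝ) (slitModel E) (dilationCurve ε) 0 (1 : ℝ)

lemma homogenizeDiff_eulerField (ε : slitDual L) (s : Sec E L) :
    homogenizeDiff ε s (eulerField E ε) = homogenize s ε := by
  have hs : HasMFDerivAt (slitModel E) 𝓘(ℝ, ℝ) (homogenize s) (dilationCurve ε 0)
      (homogenizeDiff ε s) := by
    rw [dilationCurve_zero]
    exact (mdifferentiableAt_homogenize s ε).hasMFDerivAt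
  have hcomp : HasFDerivAt (homogenize s ∘ dilationCurve ε) ((homogenizeDiff ε s).comp
      (mfderiv 𝓘(ℝ, ℝ) (slitModel E) (dilationCurve ε) 0) : ℝ →L[ℝ] ℝ) 0 :=
    (hs.comp 0 ((contMDiff_dilationCurve (E := E) ε).mdifferentiable (by simp)
      0).hasMFDerivAt).hasFDerivAt
  have hexp : HasDerivAt (homogenize s ∘ dilationCurve ε) (Real.exp 0 * homogenize s ε) 0 :=
    (Real.hasDerivAt_exp 0).mul_const (homogenize s ε)
  rw [Real.exp_zero, one_mul] at hexp
  exact hcomp.hasDerivAt.unique hexp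

lemma homogenizeDiff_apply_of_eq_zero {ε : slitDual L} {s : Sec E L} (hs : s ε.1.1 = 0)
    (v : TangentSpace (slitModel E) ε) :
    homogenizeDiff ε s v = (fibreCoord ε.1.1 ε *
      (show ℝ from mfderiv 𝓘(ℝ, E) 𝓘(ℝ, ℝ) (loc ε.1.1 s) ε.1.1
        (mfderiv (slitModel E) 𝓘(ℝ, E) (proj E L) ε v)) : ℝ) := by
  refine (mfderiv_homogenize s ε v).trans ?_
  rw [loc_eq_zero_iff.2 hs, zero_mul, add_zero]

-- The value of `s` is recovered by the Euler field, its derivative because `p` is a submersion.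
lemma ker_homogenizeDiff (ε : slitDual L) :
    LinearMap.ker (homogenizeDiff (E := E) ε) = vanishing E L (proj E L ε) := by
  ext s
  constructor
  · intro hs
    have hs' : homogenizeDiff ε s = 0 := hs
    have hval : s ε.1.1 = 0 := (pairingEquiv ε).map_eq_zero_iff.1
      ((homogenizeDiff_eulerField ε s).symm.trans (DFunLike.congr_fun hs' _))
    refine ⟨hval, ContinuousLinearMap.ext fun w => ?_⟩
    obtain ⟨v, rfl⟩ := mfderiv_proj_surjective ε w
    have hv := (homogenizeDiff_apply_of_eq_zero hval v).symm.trans (DFunLike.congr_fun hs' v)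
    exact (mul_eq_zero.1 hv).resolve_left
      (fibreCoord_ne_zero (mem_baseSet_trivializationAt ℝ L ε.1.1))
  · rintro ⟨hval, hderiv⟩
    refine ContinuousLinearMap.ext fun v =>
      (homogenizeDiff_apply_of_eq_zero (ε := ε) hval v).trans ?_
    have hderiv' : mfderiv 𝓘(ℝ, E) 𝓘(ℝ, ℝ) (loc ε.1.1 s) ε.1.1 = 0 := hderiv
    rw [hderiv']
    exact mul_zero (fibreCoord ε.1.1 ε)

lemma homogenizeDiff_dscale (r : ℝˣ) (ε : slitDual L) (s : Sec E L)
    (v : TangentSpace (slitModel E) ε) :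
    homogenizeDiff (scale r ε) s (dscale E L r ε v) = (r : ℝ) * homogenizeDiff ε s v := by
  have hcomp := mfderiv_comp ε (mdifferentiableAt_homogenize s (scale r ε))
    ((contMDiff_scale E r).mdifferentiable (by simp) ε)
  have hscale : homogenize s ∘ scale r = (r : ℝ) • homogenize s := rfl
  rw [hscale] at hcomp
  have hsmul := const_smul_mfderiv (mdifferentiableAt_homogenize s ε) (r : ℝ)
  exact (DFunLike.congr_fun hcomp v).symm.trans (DFunLike.congr_fun hsmul v)

/-! ### The cotangent bundle and the jet bundle -/

/-- The differential at `ε` of the homogenization, as a function of the `1`-jet of the section. -/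
def jetDiff (ε : slitDual L) :
    Jet E L (proj E L ε) →ₗ[ℝ] (TangentSpace (slitModel E) ε →L[ℝ] ℝ) :=
  (vanishing E L (proj E L ε)).liftQ (homogenizeDiff ε) (ker_homogenizeDiff ε).ge

lemma jetDiff_jet (ε : slitDual L) (s : Sec E L) :
    jetDiff ε (jet (proj E L ε) s) = homogenizeDiff ε s := rfl

lemma jetDiff_injective (ε : slitDual L) : Function.Injective (jetDiff (E := E) ε) :=
  LinearMap.ker_eq_bot.1 <|
    Submodule.ker_liftQ_eq_bot _ _ (ker_homogenizeDiff ε).ge (ker_homogenizeDiff ε).le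

variable [IsManifold 𝓘(ℝ, E) ∞ M]

lemma fderiv_comp_chart_symm_of_eq_affine {i x : M} (hx : x ∈ (chartAt E i).source) {h : M → ℝ}
    {b : ℝ} {α : E →L[ℝ] ℝ} (hh : ∀ᶠ y in 𝓝 x, h y = b + α (chartAt E i y)) :
    fderiv ℝ (h ∘ (chartAt E i).symm) (chartAt E i x) = α := by
  have hread : h ∘ (chartAt E i).symm =ᶠ[𝓝 (chartAt E i x)] fun z => b + α z := by
    filter_upwards [eventually_symm hx hh, (chartAt E i).open_target.mem_nhds
      ((chartAt E i).map_source hx)] with z hz hzt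
    rw [Function.comp_apply, hz, (chartAt E i).right_inv hzt]
  exact hread.fderiv_eq.trans (α.hasFDerivAt.const_add b).fderiv

variable [FiniteDimensional ℝ E]

instance : FiniteDimensional ℝ (SmoothVB.tangent (slitModel E) (slitDual L)).F :=
  inferInstanceAs (FiniteDimensional ℝ (E × (ℝ →L[ℝ] ℝ)))

instance : FiniteDimensional ℝ (SmoothVB.cotangent (slitModel E) (slitDual L)).F :=
  inferInstanceAs (FiniteDimensional ℝ ((E × (ℝ →L[ℝ] ℝ)) →L[ℝ] ℝ))

lemma smoothAt_homogenizeDiff (s : Sec E L) (ε : slitDual L) :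
    (SmoothVB.cotangent (slitModel E) (slitDual L)).SmoothAt (slitModel E) (b := fun η => η)
      (fun η => homogenizeDiff η s) ε := by
  refine SmoothVB.smoothAt_hom_of_frame contMDiffAt_id fun w =>
    SmoothVB.smoothAt_trivialLine_iff.2 ⟨contMDiffAt_id, ?_⟩
  have hframe := SmoothVB.smoothAt_frame (SmoothVB.tangent (slitModel E) (slitDual L))
    (b := fun η => η) (x₀ := ε) contMDiffAt_id w
  have htangentMap := (contMDiff_snd_tangentBundle_modelSpace ℝ 𝓘(ℝ, ℝ) (n := ∞)).comp
    ((contMDiff_homogenize s).contMDiff_tangentMap (m := ∞) (by simp))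
  exact htangentMap.contMDiffAt.comp ε hframe

variable [T2Space M]

lemma exists_loc_eventuallyEq {i : M} {h : M → ℝ}
    (hh : ContMDiffOn 𝓘(ℝ, E) 𝓘(ℝ, ℝ) ∞ h (base E L i)) :
    ∃ s : Sec E L, loc i s =ᶠ[𝓝 i] h := by
  obtain ⟨χ, hχ_one, hχ⟩ := exists_bump (E := E) (isOpen_base (E := E) (L := L) i) (mem_base i)
  refine ⟨cutSec i χ hχ h hh, ?_⟩
  filter_upwards [(isOpen_base (E := E) (L := L) i).mem_nhds (mem_base i), hχ_one] with y hy hy_one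
  rw [loc_cutSec hy, hy_one, one_mul]

variable (L) in
lemma exists_jetC_eq_affine (i : M) (b : ℝ) (α : E →L[ℝ] ℝ) : ∃ s : Sec E L, ∀ᶠ x in 𝓝 i,
    jetC i x s = (b + α (chartAt E i x), α) := by
  have haffine : ContMDiffOn 𝓘(ℝ, E) 𝓘(ℝ, ℝ) ∞ (fun y => b + α (chartAt E i y)) (base E L i) :=
    contMDiffOn_const.add (contMDiffOn_const.clm_apply
      ((contMDiffOn_chart (I := 𝓘(ℝ, E)) (x := i)).mono inter_subset_left))
  obtain ⟨s, hs⟩ := exists_loc_eventuallyEq haffine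
  refine ⟨s, ?_⟩
  filter_upwards [hs.eventually_nhds, chart_source_mem_nhds E i] with x hx hxi
  exact Prod.ext hx.self_of_nhds (fderiv_comp_chart_symm_of_eq_affine hxi hx)

lemma jetBundle_coord {i x : M} (hx : x ∈ base E L i) (s : Sec E L) :
    (jetBundle E L).coord i (jet x s) = jetC i x s :=
  jetChange_jetC (mem_base x) hx s

variable (L) in
-- A frame is constant in the coordinates `jetC`, while those of the jets of a fixed section vary.
lemma exists_jet_frame (i : M) (b : ℝ) (α : E →L[ℝ] ℝ) : ∃ s t : Sec E L, ∀ᶠ x in 𝓝 i,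
    (jetBundle E L).frame i (b, α) x = jet x s + (b - α (chartAt E i x)) • jet x t := by
  obtain ⟨s, hs⟩ := exists_jetC_eq_affine L i 0 α
  obtain ⟨t, ht⟩ := exists_jetC_eq_affine L i 1 (0 : E →L[ℝ] ℝ)
  refine ⟨s, t, ?_⟩
  filter_upwards [hs, ht, (jetBundle E L).dom_mem_nhds i] with x hsx htx hx
  refine (jetBundle E L).coord_injective hx (((jetBundle E L).coord_frame hx (b, α)).trans ?_)
  have hsx' : (jetBundle E L).coord i (jet x s) = _ := (jetBundle_coord hx s).trans hsx
  have htx' : (jetBundle E L).coord i (jet x t) = _ := (jetBundle_coord hx t).trans htx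
  have hsmul := ((jetBundle E L).coord_smul hx (b - α (chartAt E i x)) (jet x t)).trans
    (congrArg (_ • ·) htx')
  have hadd := ((jetBundle E L).coord_add hx (jet x s) _).trans (congrArg₂ (· + ·) hsx' hsmul)
  have hsum : ((b, α) : ℝ × (E →L[ℝ] ℝ)) = (0 + α (chartAt E i x), α) +
      (b - α (chartAt E i x)) • (1 + (0 : E →L[ℝ] ℝ) (chartAt E i x), 0) :=
    Prod.ext (by simp) (by simp)
  exact hsum.trans hadd.symm

lemma finrank_jet_eq_finrank_cotangentSpace (ε : slitDual L) :
    Module.finrank ℝ (Jet E L (proj E L ε)) =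
      Module.finrank ℝ (TangentSpace (slitModel E) ε →L[ℝ] ℝ) := by
  have hcoord : Jet E L (proj E L ε) ≃ₗ[ℝ] ℝ × (E →L[ℝ] ℝ) := jetEquiv E L (proj E L ε)
  refine hcoord.finrank_eq.trans (Eq.trans ?_
    (SmoothVB.finrank_continuousDual (E × (ℝ →L[ℝ] ℝ))).symm)
  rw [Module.finrank_prod, Module.finrank_prod, SmoothVB.finrank_continuousDual,
    SmoothVB.finrank_continuousDual, add_comm]

lemma jetDiff_bijective (ε : slitDual L) : Function.Bijective (jetDiff (E := E) ε) := by
  have hcoord : Jet E L (proj E L ε) ≃ₗ[ℝ] ℝ × (E →L[ℝ] ℝ) := jetEquiv E L (proj E L ε)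
  have := hcoord.symm.finiteDimensional
  have : FiniteDimensional ℝ (TangentSpace (slitModel E) ε →L[ℝ] ℝ) :=
    inferInstanceAs (FiniteDimensional ℝ ((E × (ℝ →L[ℝ] ℝ)) →L[ℝ] ℝ))
  exact ⟨jetDiff_injective ε, (LinearMap.injective_iff_surjective_of_finrank_eq_finrank
    (finrank_jet_eq_finrank_cotangentSpace ε)).1 (jetDiff_injective ε)⟩

/-- `1`-jets at the base point of `ε` are the same as covectors at `ε`. -/
def jetDiffEquiv (ε : slitDual L) :
    Jet E L (proj E L ε) ≃ₗ[ℝ] (TangentSpace (slitModel E) ε →L[ℝ] ℝ) :=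
  LinearEquiv.ofBijective (jetDiff ε) (jetDiff_bijective ε)

lemma smoothOnFrames_jetDiff : SmoothVB.SmoothOnFrames
    (A := (jetBundle E L).pullback (proj E L))
    (C := SmoothVB.cotangent (slitModel E) (slitDual L)) jetDiff := by
  intro ε w
  obtain ⟨b, α⟩ : ℝ × (E →L[ℝ] ℝ) := w
  obtain ⟨s, t, hframe⟩ := exists_jet_frame L (proj E L ε) b α
  have hproj := (proj E L).contMDiff.continuous.continuousAt (x := ε)
  have hchart : ContMDiffAt (slitModel E) 𝓘(ℝ, ℝ) ∞
      (fun η : slitDual L => b - α (chartAt E (proj E L ε) (proj E L η))) ε :=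
    contMDiffAt_const.sub (contMDiffAt_const.clm_apply
      (((contMDiffOn_chart (I := 𝓘(ℝ, E))).contMDiffAt
        (chart_source_mem_nhds E _)).comp ε (proj E L).contMDiff.contMDiffAt))
  refine ((smoothAt_homogenizeDiff s ε).add (.smul hchart (smoothAt_homogenizeDiff t ε))).congr ?_
  filter_upwards [hproj.eventually hframe,
    hproj.eventually ((jetBundle E L).dom_mem_nhds (proj E L ε))] with η hη hηdom
  have hη' := ((jetBundle E L).frame_pullback hηdom (b, α)).trans hη
  refine (congrArg (jetDiff η) hη').trans ?_
  rw [map_add, map_smul, jetDiff_jet, jetDiff_jet]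
  rfl

variable (E L) in
/-- The pull-back of `J¹L` to `L* ∖ 0` is the cotangent bundle. -/
def jetIso : ((jetBundle E L).pullback (proj E L)).Iso
    (SmoothVB.cotangent (slitModel E) (slitDual L)) :=
  SmoothVB.Iso.ofLinearEquiv (A := (jetBundle E L).pullback (proj E L))
    (C := SmoothVB.cotangent (slitModel E) (slitDual L)) jetDiffEquiv smoothOnFrames_jetDiff

/-! ### The isomorphisms -/

variable (E L) in
/-- Derivations of `L` are linear maps from `1`-jets to `L`. -/
def derIso : (derBundle E L).Iso ((jetBundle E L).hom (lineVB E L)) :=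
  SmoothVB.transportIso _ _ _

variable (E L) in
/-- The isomorphism `p_{T*}` from covectors on `L* ∖ 0` to `1`-jets of sections of `L`. -/
def cotangentIso : (SmoothVB.cotangent (slitModel E) (slitDual L)).Iso
    ((jetBundle E L).pullback (proj E L)) := (jetIso E L).symm

variable (E L) in
/-- The isomorphism `p_T` from vectors on `L* ∖ 0` to derivations of `L`, dual to `p_{T*}`. -/
def tangentIso : (SmoothVB.tangent (slitModel E) (slitDual L)).Iso
    ((derBundle E L).pullback (proj E L)) :=
  (SmoothVB.bidualIso (SmoothVB.tangent (slitModel E) (slitDual L))).trans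
    (((cotangentIso E L).homPullback (lineIso E L).symm).trans
      ((derIso E L).symm.pullback (proj E L)))

instance : FiniteDimensional ℝ (derBundle E L).F :=
  inferInstanceAs (FiniteDimensional ℝ ((ℝ × (E →L[ℝ] ℝ)) →L[ℝ] ℝ))

variable (E L) in
/-- The isomorphism `Φ` from tensors on `L* ∖ 0` to Atiyah tensors on `L`. -/
def tensorIso (l m : ℕ) : (tensors E L l m).Iso ((atiyah E L l m).pullback (proj E L)) :=
  (tangentIso E L).multiPullback ((cotangentIso E L).multiPullback (lineIso E L).symm m) l

/-- The value of `p_T` at `ε`, with the fibres in their concrete form. -/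
def tangentEquiv (ε : slitDual L) : TangentSpace (slitModel E) ε ≃ₗ[ℝ] Der E L (proj E L ε) :=
  ((tangentIso E L).toFun ε).toLinearEquiv

/-- The value of `p_{T*}` at `ε`, with the fibres in their concrete form. -/
def cotangentEquiv (ε : slitDual L) :
    (TangentSpace (slitModel E) ε →L[ℝ] ℝ) ≃ₗ[ℝ] Jet E L (proj E L ε) :=
  ((cotangentIso E L).toFun ε).toLinearEquiv

/-- The value of `Φ` at `ε`. -/
def tensorEquiv {l m : ℕ} (ε : slitDual L) :
    (tensors E L l m).V ε ≃ₗ[ℝ] (atiyah E L l m).V (proj E L ε) :=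
  ((tensorIso E L l m).toFun ε).toLinearEquiv

lemma cotangentEquiv_mfderiv (ε : slitDual L) (s : Sec E L) :
    cotangentEquiv ε (mfderiv (slitModel E) 𝓘(ℝ, ℝ) (homogenize s) ε) = jet (proj E L ε) s :=
  ((jetIso E L).toFun ε).symm_apply_apply (jet (proj E L ε) s)

lemma pairing_tangentEquiv (ε : slitDual L) (v : TangentSpace (slitModel E) ε) (s : Sec E L) :
    ε.1.2 (derApply (tangentEquiv ε v) s) =
      mfderiv (slitModel E) 𝓘(ℝ, ℝ) (homogenize s) ε v :=
  pairing_lineIso_symm (E := E) ε _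

lemma atiyahEval_tensorEquiv {l m : ℕ} (ε : slitDual L) (T : (tensors E L l m).V ε)
    (v : Fin l → TangentSpace (slitModel E) ε)
    (θ : Fin m → (TangentSpace (slitModel E) ε →L[ℝ] ℝ)) :
    atiyahEval E L l m (tensorEquiv ε T) (fun i => tangentEquiv ε (v i))
      (fun j => cotangentEquiv ε (θ j)) =
        ((lineIso E L).toFun ε).symm (tensorEval E L l m T v θ) := by
  have hvectors := (tangentIso E L).eval_multiPullback
    ((cotangentIso E L).multiPullback (lineIso E L).symm m) l T v
  have hcovectors := (cotangentIso E L).eval_multiPullback (lineIso E L).symm m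
    (SmoothVB.eval (SmoothVB.tangent _ _) _ l T v) θ
  exact (congrArg (fun S => SmoothVB.eval (jetBundle E L) (lineVB E L) (x := proj E L ε) m S
    fun j => cotangentEquiv ε (θ j)) hvectors).trans hcovectors

lemma pairing_tensorEquiv {l m : ℕ} (ε : slitDual L) (T : (tensors E L l m).V ε)
    (v : Fin l → TangentSpace (slitModel E) ε)
    (θ : Fin m → (TangentSpace (slitModel E) ε →L[ℝ] ℝ)) :
    ε.1.2 (atiyahEval E L l m (tensorEquiv ε T) (fun i => tangentEquiv ε (v i))
      (fun j => cotangentEquiv ε (θ j))) = tensorEval E L l m T v θ :=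
  (congrArg ε.1.2 (atiyahEval_tensorEquiv ε T v θ)).trans (pairing_lineIso_symm (E := E) ε _)

/-! ### Homogeneous tensors -/

lemma tangentEquiv_dscale (r : ℝˣ) (ε : slitDual L) (v : TangentSpace (slitModel E) ε) :
    tangentEquiv (scale r ε) (dscale E L r ε v) = tangentEquiv ε v := by
  refine Subtype.ext (LinearMap.ext fun s => (pairing_bijective (scale r ε)).1 ?_)
  calc (scale r ε).1.2 (derApply (tangentEquiv (scale r ε) (dscale E L r ε v)) s)
    _ = homogenizeDiff (scale r ε) s (dscale E L r ε v) := pairing_tangentEquiv _ _ s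
    _ = (r : ℝ) * homogenizeDiff ε s v := homogenizeDiff_dscale r ε s v
    _ = (r : ℝ) * ε.1.2 (derApply (tangentEquiv ε v) s) :=
      congrArg ((r : ℝ) * ·) (pairing_tangentEquiv ε v s).symm

lemma cotangentEquiv_comp_dscale (r : ℝˣ) (ε : slitDual L)
    (η : TangentSpace (slitModel E) (scale r ε) →L[ℝ] ℝ) :
    cotangentEquiv ε (η.comp (dscale E L r ε)) =
      (r : ℝ) • (show Jet E L (proj E L ε) from cotangentEquiv (scale r ε) η) := by
  obtain ⟨j, rfl⟩ := (jetDiffEquiv (scale r ε)).surjective η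
  obtain ⟨s, rfl⟩ := (vanishing E L (proj E L ε)).mkQ_surjective j
  have hcomp : (homogenizeDiff (scale r ε) s).comp (dscale E L r ε) =
      (r : ℝ) • homogenizeDiff ε s :=
    ContinuousLinearMap.ext fun v => homogenizeDiff_dscale r ε s v
  calc cotangentEquiv ε ((homogenizeDiff (scale r ε) s).comp (dscale E L r ε))
    _ = (r : ℝ) • cotangentEquiv ε (homogenizeDiff ε s) :=
      (congrArg (cotangentEquiv ε) hcomp).trans ((cotangentEquiv ε).map_smul _ _)
    _ = (r : ℝ) • jet (proj E L ε) s := congrArg ((r : ℝ) • ·) (cotangentEquiv_mfderiv ε s)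
    _ = (r : ℝ) • (show Jet E L (proj E L ε) from
        cotangentEquiv (scale r ε) (homogenizeDiff (scale r ε) s)) :=
      congrArg ((r : ℝ) • ·) (cotangentEquiv_mfderiv (scale r ε) s).symm

lemma atiyahEval_injective {l m : ℕ} {x : M} {T T' : (atiyah E L l m).V x}
    (h : ∀ Δ ψ, atiyahEval E L l m T Δ ψ = atiyahEval E L l m T' Δ ψ) : T = T' :=
  SmoothVB.eval_injective l fun Δ => SmoothVB.eval_injective m fun ψ => h Δ ψ

lemma atiyahEval_smul_right {l m : ℕ} {x : M} (T : (atiyah E L l m).V x)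
    (Δ : Fin l → Der E L x) (c : ℝ) (ψ : Fin m → Jet E L x) :
    atiyahEval E L l m T Δ (fun j => c • ψ j) = c ^ m • atiyahEval E L l m T Δ ψ :=
  SmoothVB.eval_smul_args (A := jetBundle E L) (C := lineVB E L) m c _ ψ

omit [FiniteDimensional ℝ E] [T2Space M] in
lemma tensorEval_smul {l m : ℕ} {ε : slitDual L} (c : ℝ) (T : (tensors E L l m).V ε)
    (v : Fin l → TangentSpace (slitModel E) ε)
    (θ : Fin m → (TangentSpace (slitModel E) ε →L[ℝ] ℝ)) :
    tensorEval E L l m (c • T) v θ = c * tensorEval E L l m T v θ :=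
  (congrArg (fun S => SmoothVB.eval (SmoothVB.cotangent (slitModel E) (slitDual L))
    (SmoothVB.trivialLine _ _) m S θ) (SmoothVB.eval_smul l c T v)).trans
    (SmoothVB.eval_smul (A := SmoothVB.cotangent (slitModel E) (slitDual L))
      (C := SmoothVB.trivialLine _ _) m c _ θ)

lemma tensorEval_zpow_smul_comp_dscale {l m : ℕ} (r : ℝˣ) (ε : slitDual L)
    (T : (tensors E L l m).V ε) (v : Fin l → TangentSpace (slitModel E) ε)
    (η : Fin m → (TangentSpace (slitModel E) (scale r ε) →L[ℝ] ℝ)) :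
    tensorEval E L l m ((r : ℝ) ^ (1 - (m : ℤ)) • T) v (fun j => (η j).comp (dscale E L r ε)) =
      r * ε.1.2 (atiyahEval E L l m (tensorEquiv ε T) (fun i => tangentEquiv ε (v i))
        (fun j => cotangentEquiv (scale r ε) (η j))) := by
  let Δ : Fin l → Der E L (proj E L ε) := fun i => tangentEquiv ε (v i)
  let ψ : Fin m → Jet E L (proj E L ε) := fun j => cotangentEquiv (scale r ε) (η j)
  have hψ : (fun j => cotangentEquiv ε ((η j).comp (dscale E L r ε))) = fun j => (r : ℝ) • ψ j :=
    funext fun j => cotangentEquiv_comp_dscale r ε (η j)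
  have hpow : (r : ℝ) ^ (1 - (m : ℤ)) * (r : ℝ) ^ m = r := by
    rw [← zpow_natCast, ← zpow_add₀ r.ne_zero, sub_add_cancel, zpow_one]
  calc tensorEval E L l m ((r : ℝ) ^ (1 - (m : ℤ)) • T) v
        (fun j => (η j).comp (dscale E L r ε))
    _ = (r : ℝ) ^ (1 - (m : ℤ)) * ε.1.2 (atiyahEval E L l m (tensorEquiv ε T) Δ
        (fun j => cotangentEquiv ε ((η j).comp (dscale E L r ε)))) :=
      (tensorEval_smul _ T v _).trans
        (congrArg ((r : ℝ) ^ (1 - (m : ℤ)) * ·) (pairing_tensorEquiv ε T v _).symm)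
    _ = (r : ℝ) ^ (1 - (m : ℤ)) * ε.1.2 ((r : ℝ) ^ m • atiyahEval E L l m (tensorEquiv ε T) Δ ψ) :=
      congrArg (fun a : L (proj E L ε) => (r : ℝ) ^ (1 - (m : ℤ)) * (ε.1.2 a : ℝ))
        ((congrArg (atiyahEval E L l m (tensorEquiv ε T) Δ) hψ).trans
          (atiyahEval_smul_right _ Δ (r : ℝ) ψ))
    _ = (r : ℝ) ^ (1 - (m : ℤ)) *
        ((r : ℝ) ^ m * ε.1.2 (atiyahEval E L l m (tensorEquiv ε T) Δ ψ)) :=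
      congrArg ((r : ℝ) ^ (1 - (m : ℤ)) * ·) (ε.1.2.map_smul ((r : ℝ) ^ m) _)
    _ = r * ε.1.2 (atiyahEval E L l m (tensorEquiv ε T) Δ ψ) :=
      (mul_assoc _ _ _).symm.trans (congrArg (· * _) hpow)

lemma tensorEval_dscale {l m : ℕ} (r : ℝˣ) (ε : slitDual L)
    (T : (tensors E L l m).V (scale r ε)) (v : Fin l → TangentSpace (slitModel E) ε)
    (η : Fin m → (TangentSpace (slitModel E) (scale r ε) →L[ℝ] ℝ)) :
    tensorEval E L l m T (fun i => dscale E L r ε (v i)) η =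
      r * ε.1.2 (atiyahEval E L l m (x := proj E L ε) (tensorEquiv (scale r ε) T)
        (fun i => tangentEquiv ε (v i)) (fun j => cotangentEquiv (scale r ε) (η j))) := by
  rw [← pairing_tensorEquiv, funext fun i => tangentEquiv_dscale r ε (v i)]
  rfl

lemma isHomogeneous_iff {l m : ℕ} (𝒯 : (tensors E L l m).Sec) : IsHomogeneous 𝒯 ↔
    ∀ (r : ℝˣ) (ε : slitDual L),
      (show (atiyah E L l m).V (proj E L ε) from tensorEquiv (scale r ε) (𝒯 (scale r ε))) =
        tensorEquiv ε (𝒯 ε) := by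
  refine forall_congr' fun r => forall_congr' fun ε => ⟨fun h => ?_, fun h v η => ?_⟩
  · refine atiyahEval_injective fun Δ ψ => ?_
    choose v hv using fun i => (tangentEquiv ε).surjective (Δ i)
    choose η hη using fun j => (cotangentEquiv (scale r ε)).surjective (ψ j)
    obtain rfl : (fun i => tangentEquiv ε (v i)) = Δ := funext hv
    obtain rfl : (fun j => cotangentEquiv (scale r ε) (η j)) = ψ := funext hη
    have hvalues := (tensorEval_zpow_smul_comp_dscale r ε (𝒯 ε) v η).symm.trans
      ((h v η).trans (tensorEval_dscale r ε (𝒯 (scale r ε)) v η))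
    exact ((pairing_bijective ε).1 (mul_left_cancel₀ r.ne_zero hvalues)).symm
  · refine (tensorEval_zpow_smul_comp_dscale r ε (𝒯 ε) v η).trans
      (Eq.trans ?_ (tensorEval_dscale r ε (𝒯 (scale r ε)) v η).symm)
    rw [← h]
    rfl

lemma exists_atiyah_section {l m : ℕ} {𝒯 : (tensors E L l m).Sec} (h𝒯 : IsHomogeneous 𝒯) :
    ∃ T : (atiyah E L l m).Sec, ∀ ε, tensorEquiv ε (𝒯 ε) = T (proj E L ε) := by
  choose ξ hξ using exists_dual_ne_zero L
  let τ : M → slitDual L := fun x => ⟨⟨x, ξ x⟩, hξ x⟩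
  let T : ∀ x, (atiyah E L l m).V x := fun x => tensorEquiv (τ x) (𝒯 (τ x))
  have hT (ε : slitDual L) : tensorEquiv ε (𝒯 ε) = T (proj E L ε) := by
    obtain ⟨x, r, rfl⟩ : ∃ x r, scale r (τ x) = ε :=
      ⟨proj E L ε, exists_scale_eq (ε := τ (proj E L ε)) rfl⟩
    exact (isHomogeneous_iff 𝒯).1 h𝒯 r (τ x)
  -- The set-theoretic choice `τ` need not be smooth, but near `x` any smooth section `σ` of `p`
  -- gives the same values.
  refine ⟨⟨T, fun x => ?_⟩, hT⟩
  obtain ⟨σ, -, hσ, hprojσ⟩ := exists_localSection E (τ x)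
  have hsmooth := (SmoothVB.smoothAt_pullback_iff.1
    ((tensorIso E L l m).smoothAt (SmoothVB.smoothAt_section 𝒯 hσ))).2
  refine ContMDiffAt.congr_of_eventuallyEq hsmooth ?_
  filter_upwards [hprojσ] with y hy
  have hval : tensorEquiv (σ y) (𝒯 (σ y)) = T (proj E L (σ y)) := hT (σ y)
  exact (congrArg (fun z => (⟨z, T z⟩ : TotalSpace (atiyah E L l m).F (atiyah E L l m).V))
    hy).symm.trans (congrArg (TotalSpace.mk _) hval.symm)

lemma isHomogeneous_iff_exists {l m : ℕ} (𝒯 : (tensors E L l m).Sec) : IsHomogeneous 𝒯 ↔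
    ∃ T : (atiyah E L l m).Sec, ∀ ε, tensorEquiv ε (𝒯 ε) = T (proj E L ε) := by
  refine ⟨exists_atiyah_section, ?_⟩
  rintro ⟨T, hT⟩
  exact (isHomogeneous_iff 𝒯).2 fun r ε => (hT (scale r ε)).trans (hT ε).symm

variable (E L) in
/-- The tensor on `L* ∖ 0` corresponding to an Atiyah tensor, i.e. `T ↦ Φ⁻¹ ∘ p^* T`. -/
def homogeneousTensor (l m : ℕ) : (atiyah E L l m).Sec →ₗ[ℝ] (tensors E L l m).Sec where
  toFun T := ⟨fun ε => (tensorEquiv ε).symm (T (proj E L ε)), fun _ =>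
    (tensorIso E L l m).symm.smoothAt (b := fun ε => ε) (SmoothVB.smoothAt_pullback_iff.2
      ⟨contMDiffAt_id, SmoothVB.smoothAt_section T (proj E L).contMDiff.contMDiffAt⟩)⟩
  map_add' _ _ := ContMDiffSection.ext fun ε => (tensorEquiv ε).symm.map_add _ _
  map_smul' _ _ := ContMDiffSection.ext fun ε => (tensorEquiv ε).symm.map_smul _ _

lemma tensorEquiv_homogeneousTensor {l m : ℕ} (T : (atiyah E L l m).Sec) (ε : slitDual L) :
    tensorEquiv ε (homogeneousTensor E L l m T ε) = T (proj E L ε) :=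
  (tensorEquiv ε).apply_symm_apply (T (proj E L ε))

lemma homogeneousTensor_injective (l m : ℕ) :
    Function.Injective (homogeneousTensor E L l m) := by
  intro T T' h
  refine ContMDiffSection.ext fun x => ?_
  obtain ⟨ξ, hξ⟩ := exists_dual_ne_zero L x
  let ε : slitDual L := ⟨⟨x, ξ⟩, hξ⟩
  exact (tensorEquiv_homogeneousTensor T ε).symm.trans
    ((congrArg (fun 𝒯 => tensorEquiv ε (𝒯 ε)) h).trans (tensorEquiv_homogeneousTensor T' ε))

lemma range_homogeneousTensor (l m : ℕ) :
    Set.range (homogeneousTensor E L l m) = {𝒯 | IsHomogeneous 𝒯} := by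
  ext 𝒯
  refine Iff.trans ⟨?_, ?_⟩ (isHomogeneous_iff_exists 𝒯).symm
  · rintro ⟨T, rfl⟩
    exact ⟨T, tensorEquiv_homogeneousTensor T⟩
  · rintro ⟨T, hT⟩
    exact ⟨T, ContMDiffSection.ext fun ε => (tensorEquiv ε).injective
      ((tensorEquiv_homogeneousTensor T ε).trans (hT ε).symm)⟩

end LineBundle

end

theorem mainTheorem8 {E : Type} [NormedAddCommGroup E] [NormedSpace ℝ E] [FiniteDimensional ℝ E]
    {M : Type u} [TopologicalSpace M] [T2Space M] [ChartedSpace E M] [IsManifold 𝓘(ℝ, E) ∞ M]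
    (L : M → Type u) [TopologicalSpace (TotalSpace ℝ L)] [∀ x, AddCommGroup (L x)]
    [∀ x, Module ℝ (L x)] [∀ x, TopologicalSpace (L x)] [FiberBundle ℝ L] [VectorBundle ℝ ℝ L]
    [ContMDiffVectorBundle ∞ ℝ L 𝓘(ℝ, E)] :
    ∃ (pT : (SmoothVB.tangent (slitModel E) (slitDual L)).Iso
          ((derBundle E L).pullback (proj E L)))
      (pT' : (SmoothVB.cotangent (slitModel E) (slitDual L)).Iso
          ((jetBundle E L).pullback (proj E L))),
      (∀ (ε : slitDual L) (v : TangentSpace (slitModel E) ε) (s : Sec E L),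
        ε.1.2 (derApply (x := proj E L ε) (pT.toFun ε v) s) =
          mfderiv (slitModel E) 𝓘(ℝ, ℝ) (homogenize s) ε v) ∧
      (∀ (ε : slitDual L) (s : Sec E L),
        pT'.toFun ε (mfderiv (slitModel E) 𝓘(ℝ, ℝ) (homogenize s) ε) = jet (proj E L ε) s) ∧
      ∀ l m : ℕ,
        ∃ Φ : (tensors E L l m).Iso ((atiyah E L l m).pullback (proj E L)),
          (∀ (ε : slitDual L) (T : (tensors E L l m).V ε)
            (v : Fin l → TangentSpace (slitModel E) ε)
            (θ : Fin m → (TangentSpace (slitModel E) ε →L[ℝ] ℝ)),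
            ε.1.2 (atiyahEval E L l m (x := proj E L ε) (Φ.toFun ε T)
                (fun i => pT.toFun ε (v i)) (fun j => pT'.toFun ε (θ j))) =
              tensorEval E L l m T v θ) ∧
          (∀ 𝒯 : (tensors E L l m).Sec, IsHomogeneous 𝒯 ↔
            ∃ T : (atiyah E L l m).Sec, ∀ ε, Φ.toFun ε (𝒯 ε) = T (proj E L ε)) ∧
          ∃ h : (atiyah E L l m).Sec →ₗ[ℝ] (tensors E L l m).Sec,
            Function.Injective h ∧ Set.range h = {𝒯 | IsHomogeneous 𝒯} ∧
            ∀ (T : (atiyah E L l m).Sec) (ε : slitDual L),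
              Φ.toFun ε (h T ε) = T (proj E L ε) := by
  exact ⟨tangentIso E L, cotangentIso E L, pairing_tangentEquiv, cotangentEquiv_mfderiv,
    fun l m => ⟨tensorIso E L l m, pairing_tensorEquiv, isHomogeneous_iff_exists,
      homogeneousTensor E L l m, homogeneousTensor_injective l m, range_homogeneousTensor l m,
      tensorEquiv_homogeneousTensor⟩⟩
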